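/- **Theorem 3.1.** Let $n\ge 1$ and let $K=\mathbb{Q}(\theta)$ be a number field, where $\theta$ has minimal polynomial $x^n-a$ over $\mathbb{Q}$ and $a$ is an $n$-th power free integer such that for every prime $p\mid n$ either $p\nmid a$ or $v_p(a)$ is coprime to $p$. Write $|a|=\prod_{j=1}^{n-1}a_j^{\,j}$ with positive squarefree integers $a_j$ that are coprime in pairs, and put $C_m=\prod_{j=1}^{n-1}a_j^{\lfloor jm/n\rfloor}$ for $0\le m\le n-1$. Let $n=\prod_{i=1}^{k}p_i^{s_i}$ be the prime factorization of $n$, let $r_i=v_{p_i}(a^{p_i-1}-1)-1$, and let $S=\{i : r_i\ge 1\}$. For $i\in S$ and $0\le m\le n-1$ let $k_{i,m}$ be the largest integer $k$ with $0\le k\le\min\{r_i,s_i\}$ and $n-n/p_i^{k}\le m$, and define $j_{i,m}\ge 0$ by $m=n-n/p_i^{k_{i,m}}+j_{i,m}$. Let $S_m=\{i\in S: k_{i,m}\ge 1\}$. For $0\le m\le n-1$ and $i\in S_m$ choose integers $b'_{i,m}$, $w_{i,m}$, $u_{i,m}$ as follows (such choices exist, and any choice is allowed): - $a\,b'_{i,m}\equiv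 1 \pmod{p_i^{k_{i,m}+1}}$; put $a'_{i,m}=(b'_{i,m})^{p_i^{s_i-1-k_{i,m}}}$ if $k_{i,m}<s_i$ and $a'_{i,m}=b'_{i,m}$ if $k_{i,m}=s_i$; - $w_{i,m}\,C_m\,(a'_{i,m})^{p_i^{k_{i,m}}-1}\equiv 1\pmod{p_i^{k_{i,m}}}$; - $\sum_{i\in S_m}u_{i,m}z_{i,m}=1$ whenever $S_m\ne\emptyset$, where $z_{i,m}=\prod_{l\in S_m\setminus\{i\}}p_l^{k_{l,m}}$. Put $$\delta_{i,m}=w_{i,m}\,C_m\,\theta^{j_{i,m}}\sum_{r=0}^{p_i^{k_{i,m}}-2}\bigl(a'_{i,m}\,\theta^{\,n/p_i^{k_{i,m}}}\bigr)^{r},\qquad \beta_m=\sum_{i\in S_m}u_{i,m}z_{i,m}\delta_{i,m},$$ so that $\beta_m=0$ if $S_m=\emptyset$. An integral basis of $K$ is a $\mathbb{Z}$-basis of its ring of algebraic integers. Then: (i) If $S=\emptyset$, then $\{\theta^m/C_m : 0\le m\le n-1\}$ is an integral basis of $K$. (ii) If $S\neq\emptyset$, then $$\{1\}\cup\Bigl\{\frac{\theta^m+\beta_m}{C_m\prod_{i\in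 S}p_i^{k_{i,m}}} : 1\le m\le n-1\Bigr\}$$ is an integral basis of $K$. -/

import Mathlib

namespace PureField

/-- `a` is `n`-th power free: no `n`-th power of a non-unit integer divides `a`. -/
def IsPowerFree (n : ℕ) (a : ℤ) : Prop :=
  ∀ t : ℤ, t ^ n ∣ a → IsUnit t

/-- `|a| = ∏_{j=1}^{n-1} c_j ^ j` with positive squarefree integers `c_j`, coprime in pairs. -/
structure IsDecomposition (n : ℕ) (a : ℤ) (c : ℕ → ℕ) : Prop where
  squarefree : ∀ j ∈ Finset.Icc 1 (n - 1), Squarefree (c j)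
  coprime : ∀ i ∈ Finset.Icc 1 (n - 1), ∀ j ∈ Finset.Icc 1 (n - 1),
    i ≠ j → Nat.Coprime (c i) (c j)
  prod_eq : ∏ j ∈ Finset.Icc 1 (n - 1), c j ^ j = a.natAbs

/-- `C_m = ∏_{j=1}^{n-1} c_j ^ ⌊j m / n⌋`. -/
def coeffC (n : ℕ) (c : ℕ → ℕ) (m : ℕ) : ℕ :=
  ∏ j ∈ Finset.Icc 1 (n - 1), c j ^ (j * m / n)

/-- `r_p = v_p (a ^ (p - 1) - 1) - 1`, an integer which is at least `-1`. -/
def expR (a : ℤ) (p : ℕ) : ℤ :=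
  (padicValInt p (a ^ (p - 1) - 1) : ℤ) - 1

/-- The set `S`; the indices `i` are replaced by the prime divisors `p_i` of `n` themselves. -/
def setS (n : ℕ) (a : ℤ) : Finset ℕ :=
  n.primeFactors.filter fun p => 1 ≤ expR a p

/-- `d_p = min {r_p, s_p}`, where `p ^ s_p` is the exact power of `p` dividing `n`
(used only for `p ∈ S`, so that `r_p ≥ 1`). -/
def expD (n : ℕ) (a : ℤ) (p : ℕ) : ℕ :=
  min (expR a p).toNat (n.factorization p)

/-- `k_{p,m}`: the largest `k` with `0 ≤ k ≤ d_p` and `n - n / p ^ k ≤ m`. -/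
def expK (n : ℕ) (a : ℤ) (p m : ℕ) : ℕ :=
  Nat.findGreatest (fun k => n - n / p ^ k ≤ m) (expD n a p)

/-- `j_{p,m}`, given by `m = n - n / p ^ k_{p,m} + j_{p,m}`. -/
def expJ (n : ℕ) (a : ℤ) (p m : ℕ) : ℕ :=
  m - (n - n / p ^ expK n a p m)

/-- `S_m`: the set of `p ∈ S` with `k_{p,m} ≥ 1`. -/
def setSm (n : ℕ) (a : ℤ) (m : ℕ) : Finset ℕ :=
  (setS n a).filter fun p => 1 ≤ expK n a p m

/-- `a'_{p,m}`, which is `b' ^ (p ^ (s_p - 1 - k_{p,m}))` if `k_{p,m} < s_p`, and `b'` if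
`k_{p,m} = s_p`; here `b'` is a chosen inverse of `a` modulo `p ^ (k_{p,m} + 1)`. -/
def aPrime (n : ℕ) (a : ℤ) (b : ℕ → ℕ → ℤ) (p m : ℕ) : ℤ :=
  if expK n a p m < n.factorization p then
    b p m ^ p ^ (n.factorization p - 1 - expK n a p m)
  else b p m

/-- `z_{p,m} = ∏_{q ∈ S_m, q ≠ p} q ^ k_{q,m}`. -/
def coeffZ (n : ℕ) (a : ℤ) (p m : ℕ) : ℕ :=
  ∏ q ∈ (setSm n a m).erase p, q ^ expK n a q m

/-- The integers `b'_{p,m}`, `w_{p,m}`, `u_{p,m}` (for `0 ≤ m ≤ n - 1` and `p ∈ S_m`) satisfy the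
conditions under which they may be chosen. -/
structure IsAdmissible (n : ℕ) (a : ℤ) (c : ℕ → ℕ) (b w u : ℕ → ℕ → ℤ) : Prop where
  inv : ∀ m < n, ∀ p ∈ setSm n a m,
    a * b p m ≡ 1 [ZMOD (p : ℤ) ^ (expK n a p m + 1)]
  weight : ∀ m < n, ∀ p ∈ setSm n a m,
    w p m * (coeffC n c m : ℤ) * aPrime n a b p m ^ (p ^ expK n a p m - 1)
      ≡ 1 [ZMOD (p : ℤ) ^ expK n a p m]
  bezout : ∀ m < n, (setSm n a m).Nonempty →
    ∑ p ∈ setSm n a m, u p m * (coeffZ n a p m : ℤ) = 1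

section

variable {K : Type*} [Field K]

/-- `δ_{p,m} = w_{p,m} C_m θ ^ j_{p,m} ∑_{r=0}^{p^k-2} (a'_{p,m} θ ^ (n / p^k)) ^ r`
with `k = k_{p,m}`. -/
def delta (n : ℕ) (a : ℤ) (c : ℕ → ℕ) (b w : ℕ → ℕ → ℤ) (θ : K) (p m : ℕ) : K :=
  (w p m : K) * (coeffC n c m : K) * θ ^ expJ n a p m *
    ∑ r ∈ Finset.range (p ^ expK n a p m - 1),
      ((aPrime n a b p m : K) * θ ^ (n / p ^ expK n a p m)) ^ r

/-- `β_m = ∑_{p ∈ S_m} u_{p,m} z_{p,m} δ_{p,m}`, which is `0` if `S_m` is empty. -/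
def beta (n : ℕ) (a : ℤ) (c : ℕ → ℕ) (b w u : ℕ → ℕ → ℤ) (θ : K) (m : ℕ) : K :=
  ∑ p ∈ setSm n a m, (u p m : K) * (coeffZ n a p m : K) * delta n a c b w θ p m

/-- The family `v` is an integral basis of `K`, i.e. a `ℤ`-basis of its ring of integers. -/
def IsIntegralBasis {ι : Type*} (v : ι → K) : Prop :=
  ∃ B : Module.Basis ι ℤ (NumberField.RingOfIntegers K), ∀ i, (B i : K) = v i

end

end PureField

namespace PureField

open Polynomial Finset

set_option linter.unusedSectionVars false

/-! ### Ultrametric estimates. -/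

section Ultrametric

variable {C : Type*} [NormedField C] [IsUltrametricDist C]

/-! The m-th element of the family is g_m(θ), with g_m of degree m and leading coefficient 1 /
`denom n a c m`. Two facts suffice: (1) every g_m(θ) is integral; (2) if h(θ) is integral and deg h
= t < n, then `denom n a c t` times the leading coefficient of h is an integer. Subtracting integer
multiples of the g_t then lowers the degree (`aeval_mem_span`). Both are tested prime by prime in an
algebraically closed ultrametric field C over ℚ_p: as X^n - a is the minimal polynomial of θ, h(θ)
is integral exactly when, for every p, ‖h(y)‖ ≤ 1 at all y with y^n = a.

(1) At p ∈ S_m with k = k_{p,m}, the congruences on w and a' turn y^m + δ into a multiple of a full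
geometric sum ∑_{r < p^k} T^r with T^(p^k) ≡ 1 mod p^(k+1), of norm at most p^(-k)
(`norm_geom_sum_le`); the Bézout coefficients glue the primes. At other primes ‖y‖^n = ‖a‖ and the
factor C_m in δ suffice.

(2) Let n = n' p^s with p ∤ n'. Averaging over n'-th roots of unity splits h by exponents mod n' at
no cost. If p ∣ a or p ∤ n, the terms of one class have distinct norms
(`norm_coeff_pow_mul_le_one`). If p ∣ n and p ∤ a, everything reduces to polynomials in η with
η^(p^s) = a, and the core is `prime_dvd_of_norm_le`: an integer polynomial of degree < p^s that is
at most p^(-(k+1)) at all such η is divisible by p, given k = s, exactness of the p-power in a^(p-1)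
- 1, or a degree bound. Its proof is a descent (`prime_dvd_of_descent`): with Y = η^(p^(s-1)) and
Y^p near b^p, divide by F = (Y^p - b^p)/(Y - b). Where ‖Y - b‖^(p-1) = 1/p, powers of η - c have
distinct norms up to deg F, so the remainder is divisible; at a root Y nearer to b, F has norm
exactly 1/p, so the quotient loses one power of p. The descent stops when the degree is exhausted,
at a totally ramified layer (`prime_dvd_of_near`), or for p = 2 at an unramified quadratic layer
followed by a totally ramified one (`two_dvd_of_near`). -/

theorem norm_eq_of_norm_sub_lt {x y : C} (h : ‖x - y‖ < ‖y‖) : ‖x‖ = ‖y‖ := by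
  have := IsUltrametricDist.norm_add_eq_max_of_norm_ne_norm (x := x - y) (y := y) h.ne
  rwa [sub_add_cancel, max_eq_right h.le] at this

theorem norm_sub_le_of_le {x y : C} {r : ℝ} (hx : ‖x‖ ≤ r) (hy : ‖y‖ ≤ r) : ‖x - y‖ ≤ r := by
  rw [sub_eq_add_neg]
  exact (IsUltrametricDist.norm_add_le_max _ _).trans (max_le hx (by rwa [norm_neg]))

theorem norm_add_le_of_le {x y : C} {r : ℝ} (hx : ‖x‖ ≤ r) (hy : ‖y‖ ≤ r) : ‖x + y‖ ≤ r :=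
  (IsUltrametricDist.norm_add_le_max _ _).trans (max_le hx hy)

theorem norm_add_lt_of_lt {x y : C} {r : ℝ} (hx : ‖x‖ < r) (hy : ‖y‖ < r) : ‖x + y‖ < r :=
  (IsUltrametricDist.norm_add_le_max _ _).trans_lt (max_lt hx hy)

/-- Terms of distinct norms cannot cancel: the sum has the norm of its largest term. -/
theorem norm_le_of_norm_sum_le {ι : Type*} {s : Finset ι} {f : ι → C} {r : ℝ}
    (hf : ∀ i ∈ s, ∀ j ∈ s, f i ≠ 0 → f j ≠ 0 → ‖f i‖ = ‖f j‖ → i = j) (hr : 0 ≤ r)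
    (h : ‖∑ i ∈ s, f i‖ ≤ r) : ∀ i ∈ s, ‖f i‖ ≤ r := by
  classical
  intro i hi
  by_cases h0 : f i = 0
  · simpa [h0] using hr
  have hi' : i ∈ s.filter fun i => f i ≠ 0 := by simp [hi, h0]
  have key := IsUltrametricDist.norm_sum_eq_sup'_of_pairwise_ne (f := f) ⟨i, hi'⟩ (by
    intro j hj k hk hjk h'
    simp only [coe_filter, Set.mem_ofPred_eq] at hj hk
    exact hjk (hf j hj.1 k hk.1 hj.2 hk.2 h'))
  rw [Finset.sum_filter_ne_zero] at key
  calc ‖f i‖ ≤ _ := Finset.le_sup' (fun i => ‖f i‖) hi'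
    _ = _ := key.symm
    _ ≤ r := h

/-- The homogenized geometric sum `(y ^ p - c ^ p) / (y - c)`. -/
def geomSum₂ {R : Type*} [CommRing R] (p : ℕ) (y c : R) : R :=
  ∑ i ∈ range p, y ^ i * c ^ (p - 1 - i)

theorem geomSum₂_mul {R : Type*} [CommRing R] (p : ℕ) (y c : R) :
    geomSum₂ p y c * (y - c) = y ^ p - c ^ p := geom_sum₂_mul y c p

end Ultrametric

/-! ### Norms of y^p - c^p near and far from c. -/

section PAdic

variable {p : ℕ} [hp : Fact p.Prime] {C : Type*} [NormedField C] [NormedAlgebra ℚ_[p] C]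

theorem norm_intCast_eq (z : ℤ) : ‖(z : C)‖ = ‖(z : ℚ_[p])‖ := by
  rw [← norm_algebraMap' C (z : ℚ_[p]), map_intCast]

theorem norm_natCast_eq (z : ℕ) : ‖(z : C)‖ = ‖(z : ℚ_[p])‖ := by
  exact_mod_cast norm_intCast_eq (p := p) (C := C) z

theorem norm_ratCast_eq [CharZero C] (z : ℚ) : ‖(z : C)‖ = ‖(z : ℚ_[p])‖ := by
  rw [← norm_algebraMap' C (z : ℚ_[p]), map_ratCast]

variable (p C) in
theorem norm_prime : ‖(p : C)‖ = (p : ℝ)⁻¹ := by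
  rw [norm_natCast_eq (p := p), Padic.norm_p]

theorem inv_prime_pos (p : ℕ) [hp : Fact p.Prime] : (0 : ℝ) < (p : ℝ)⁻¹ :=
  inv_pos.2 (by exact_mod_cast hp.out.pos)

theorem inv_prime_lt_one (p : ℕ) [hp : Fact p.Prime] : (p : ℝ)⁻¹ < 1 :=
  inv_lt_one_of_one_lt₀ (by exact_mod_cast hp.out.one_lt)

theorem norm_intCast_le_iff {z : ℤ} {m : ℕ} :
    ‖(z : C)‖ ≤ (p : ℝ)⁻¹ ^ m ↔ (p : ℤ) ^ m ∣ z := by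
  rw [norm_intCast_eq (p := p), ← Padic.norm_int_le_pow_iff_dvd, inv_pow, zpow_neg, zpow_natCast]

theorem norm_intCast_le_one' (p : ℕ) [Fact p.Prime] {C : Type*} [NormedField C]
    [NormedAlgebra ℚ_[p] C] (z : ℤ) : ‖(z : C)‖ ≤ 1 := by
  simpa using (norm_intCast_le_iff (p := p) (C := C) (z := z) (m := 0)).2 (by simp)

theorem norm_intCast_eq_one {z : ℤ} : ‖(z : C)‖ = 1 ↔ ¬ (p : ℤ) ∣ z := by
  rw [norm_intCast_eq (p := p), Padic.norm_intCast_eq_one_iff, Int.isCoprime_iff_gcd_eq_one,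
    Int.gcd_comm, ← Int.isCoprime_iff_gcd_eq_one,
    (Nat.prime_iff_prime_int.1 hp.out).coprime_iff_not_dvd]

theorem norm_intCast_eq_pow {z : ℤ} {m : ℕ} (h : (p : ℤ) ^ m ∣ z) (h' : ¬ (p : ℤ) ^ (m + 1) ∣ z) :
    ‖(z : C)‖ = (p : ℝ)⁻¹ ^ m := by
  obtain ⟨w, rfl⟩ := h
  have hw : ¬ (p : ℤ) ∣ w := fun hw => h' (by rw [pow_succ]; exact mul_dvd_mul_left _ hw)
  rw [Int.cast_mul, norm_mul, norm_intCast_eq_one.2 hw, mul_one, Int.cast_pow, norm_pow,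
    Int.cast_natCast, norm_prime]

theorem exists_norm_intCast_eq_pow {z : ℤ} (hz : z ≠ 0) :
    ∃ v : ℕ, ‖(z : C)‖ = (p : ℝ)⁻¹ ^ v := by
  obtain ⟨w, hw, h⟩ := (Int.finiteMultiplicity_iff.2
    ⟨by simpa using hp.out.ne_one, hz⟩ : FiniteMultiplicity (p : ℤ) z).exists_eq_pow_mul_and_not_dvd
  refine ⟨multiplicity (p : ℤ) z, norm_intCast_eq_pow ⟨w, hw⟩ fun h' => ?_⟩
  rw [pow_succ] at h'
  nth_rw 2 [hw] at h'
  exact h (Int.dvd_of_mul_dvd_mul_left (pow_ne_zero _ (by exact_mod_cast hp.out.ne_zero)) h')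

theorem norm_lt_one_of_pow_lt {C : Type*} [NormedField C] {x : C} {m : ℕ} (h : ‖x‖ ^ m < 1) : ‖x‖ < 1 := by
  by_contra! h'
  exact absurd (one_le_pow₀ h' (n := m)) (not_le.2 h)

variable [IsUltrametricDist C]

theorem norm_aeval_le_one (p : ℕ) [Fact p.Prime] {C : Type*} [NormedField C]
    [NormedAlgebra ℚ_[p] C] [IsUltrametricDist C] (g : ℤ[X]) {y : C} (hy : ‖y‖ ≤ 1) :
    ‖aeval y g‖ ≤ 1 := by
  rw [aeval_eq_sum_range]
  refine IsUltrametricDist.norm_sum_le_of_forall_le_of_nonneg zero_le_one fun i _ => ?_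
  rw [zsmul_eq_mul, norm_mul, norm_pow]
  exact mul_le_one₀ (norm_intCast_le_one' p _) (by positivity) (pow_le_one₀ (norm_nonneg _) hy)

/-- Binomial expansion of ((x + c)^p - c^p)/x with x = y - c: besides the two extreme terms,
everything is divisible by p x. The two extreme terms balance at ‖y - c‖^(p-1) = 1/p, the threshold
of all later case distinctions. -/
theorem norm_geomSum₂_sub_le {y c : C} (hy : ‖y‖ ≤ 1) (hc : ‖c‖ ≤ 1) :
    ‖geomSum₂ p y c - ((y - c) ^ (p - 1) + p * c ^ (p - 1))‖ ≤ (p : ℝ)⁻¹ * ‖y - c‖ := by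
  obtain ⟨x, rfl⟩ : ∃ x, y = x + c := ⟨y - c, by ring⟩
  have hx : ‖x‖ ≤ 1 := by simpa using norm_sub_le_of_le hy hc
  rw [add_sub_cancel_right]
  obtain ⟨q, hq⟩ : ∃ q, p = q + 2 := ⟨p - 2, by have := hp.out.two_le; omega⟩
  rcases eq_or_ne x 0 with rfl | hx0
  · have : ∀ i ∈ range p, c ^ i * c ^ (p - 1 - i) = c ^ (p - 1) := fun i hi => by
      rw [← pow_add]; congr 1; have := mem_range.1 hi; omega
    have h0 : (0 : C) ^ (p - 1) = 0 := zero_pow (by omega)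
    simp [geomSum₂, sum_congr rfl this, h0]
  have hx' : 0 < ‖x‖ := norm_pos_iff.2 hx0
  rw [← mul_le_mul_iff_of_pos_right hx', ← norm_mul]
  have h1 := geomSum₂_mul p (x + c) c
  have h2 := add_pow_prime_eq hp.out x c
  rw [add_sub_cancel_right] at h1
  have h3 : (∑ k ∈ Ioo 0 p, x ^ (k - 1) * c ^ (p - k - 1) * ((p.choose k / p : ℕ) : C))
      = c ^ (p - 2) + x * ∑ k ∈ Ioo 1 p, x ^ (k - 2) * c ^ (p - k - 1) * ((p.choose k / p : ℕ) : C) := by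
    have hsub : x * ∑ k ∈ Ioo 1 p, x ^ (k - 2) * c ^ (p - k - 1) * ((p.choose k / p : ℕ) : C)
        = ∑ k ∈ Ioo 1 p, x ^ (k - 1) * c ^ (p - k - 1) * ((p.choose k / p : ℕ) : C) := by
      rw [mul_sum]
      refine sum_congr rfl fun k hk => ?_
      have : 1 < k := (mem_Ioo.1 hk).1
      rw [show k - 1 = (k - 2) + 1 by omega, pow_succ]
      ring
    have hset : Ioo 0 p = insert 1 (Ioo 1 p) := by
      ext k; simp only [mem_Ioo, mem_insert]; omega
    rw [hsub, hset, sum_insert (by simp)]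
    simp [Nat.div_self hp.out.pos, show p - 1 - 1 = p - 2 by omega]
  set R := ∑ k ∈ Ioo 1 p, x ^ (k - 2) * c ^ (p - k - 1) * ((p.choose k / p : ℕ) : C) with hR
  have hRn : ‖R‖ ≤ 1 := by
    refine IsUltrametricDist.norm_sum_le_of_forall_le_of_nonneg zero_le_one fun i _ => ?_
    rw [norm_mul, norm_mul, norm_pow, norm_pow]
    exact mul_le_one₀ (mul_le_one₀ (pow_le_one₀ (norm_nonneg _) hx) (by positivity)
      (pow_le_one₀ (norm_nonneg _) hc)) (norm_nonneg _) (IsUltrametricDist.norm_natCast_le_one _ _)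
  have h4 : (geomSum₂ p (x + c) c - (x ^ (p - 1) + p * c ^ (p - 1))) * x = p * x * x * (c * R) := by
    have e1 : x ^ p = x ^ (p - 1) * x := by rw [← pow_succ]; congr 1; omega
    have e2 : c ^ (p - 1) = c ^ (p - 2) * c := by rw [← pow_succ]; congr 1; omega
    rw [sub_mul, h1, h2, h3, e1, e2]
    ring
  rw [h4, norm_mul, norm_mul, norm_mul, norm_prime]
  refine mul_le_of_le_one_right (by positivity) ?_
  rw [norm_mul]
  exact mul_le_one₀ hc (norm_nonneg _) hRn

theorem norm_geomSum₂_of_lt {y c : C} (hy : ‖y‖ ≤ 1) (hc : ‖c‖ = 1)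
    (h : ‖y - c‖ ^ (p - 1) < (p : ℝ)⁻¹) : ‖geomSum₂ p y c‖ = (p : ℝ)⁻¹ := by
  have h0 := inv_prime_pos p
  have hlt : ‖y - c‖ < 1 := norm_lt_one_of_pow_lt (h.trans (inv_prime_lt_one p))
  have hn : ‖(p : C) * c ^ (p - 1)‖ = (p : ℝ)⁻¹ := by
    rw [norm_mul, norm_pow, hc, one_pow, mul_one, norm_prime]
  rw [← hn]
  refine norm_eq_of_norm_sub_lt ?_
  rw [hn, show geomSum₂ p y c - p * c ^ (p - 1)
    = (geomSum₂ p y c - ((y - c) ^ (p - 1) + p * c ^ (p - 1))) + (y - c) ^ (p - 1) by ring]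
  refine norm_add_lt_of_lt ((norm_geomSum₂_sub_le hy hc.le).trans_lt ?_) (by rwa [norm_pow])
  exact mul_lt_of_lt_one_right h0 hlt

theorem norm_geomSum₂_of_gt {y c : C} (hy : ‖y‖ ≤ 1) (hc : ‖c‖ ≤ 1)
    (h : (p : ℝ)⁻¹ < ‖y - c‖ ^ (p - 1)) : ‖geomSum₂ p y c‖ = ‖y - c‖ ^ (p - 1) := by
  have h0 := inv_prime_pos p
  rw [← norm_pow]
  refine norm_eq_of_norm_sub_lt ?_
  rw [norm_pow, show geomSum₂ p y c - (y - c) ^ (p - 1)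
    = (geomSum₂ p y c - ((y - c) ^ (p - 1) + p * c ^ (p - 1))) + p * c ^ (p - 1) by ring]
  refine (norm_add_le_of_le ((norm_geomSum₂_sub_le hy hc).trans ?_) ?_).trans_lt h
  · exact mul_le_of_le_one_right h0.le (norm_sub_le_of_le hy hc)
  · rw [norm_mul, norm_prime, norm_pow]
    exact mul_le_of_le_one_right h0.le (pow_le_one₀ (norm_nonneg _) hc)

theorem norm_geomSum₂_le {y c : C} (hy : ‖y‖ ≤ 1) (hc : ‖c‖ ≤ 1)
    (h : ‖y - c‖ ^ (p - 1) ≤ (p : ℝ)⁻¹) : ‖geomSum₂ p y c‖ ≤ (p : ℝ)⁻¹ := by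
  have h0 := inv_prime_pos p
  rw [show geomSum₂ p y c = (geomSum₂ p y c - ((y - c) ^ (p - 1) + p * c ^ (p - 1)))
    + ((y - c) ^ (p - 1) + p * c ^ (p - 1)) by ring]
  refine norm_add_le_of_le ((norm_geomSum₂_sub_le hy hc).trans ?_) (norm_add_le_of_le ?_ ?_)
  · exact mul_le_of_le_one_right h0.le (norm_sub_le_of_le hy hc)
  · rwa [norm_pow]
  · rw [norm_mul, norm_prime, norm_pow]
    exact mul_le_of_le_one_right h0.le (pow_le_one₀ (norm_nonneg _) hc)

/-- If y were at or below the threshold, ‖y^p - c^p‖^(p-1) would be at most p^(-p). Above it, (y -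
c)^(p-1) dominates the cofactor. -/
theorem norm_sub_pow_prime_eq {y c : C} (hy : ‖y‖ ≤ 1) (hc : ‖c‖ ≤ 1)
    (h : (p : ℝ)⁻¹ ^ p < ‖y ^ p - c ^ p‖ ^ (p - 1)) : ‖y - c‖ ^ p = ‖y ^ p - c ^ p‖ := by
  have h0 := inv_prime_pos p
  have hp1 : p - 1 + 1 = p := Nat.sub_add_cancel hp.out.one_le
  rw [← geomSum₂_mul, norm_mul]
  by_cases hle : ‖y - c‖ ^ (p - 1) ≤ (p : ℝ)⁻¹
  · refine absurd h (not_lt.2 ?_)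
    rw [← geomSum₂_mul, norm_mul, mul_pow]
    calc _ ≤ (p : ℝ)⁻¹ ^ (p - 1) * (p : ℝ)⁻¹ := by
          gcongr
          exact norm_geomSum₂_le hy hc hle
      _ = _ := by rw [← pow_succ, hp1]
  · rw [norm_geomSum₂_of_gt hy hc (not_le.1 hle), ← pow_succ, hp1]

theorem norm_sub_pow_prime_pow_eq {y c : C} (hy : ‖y‖ ≤ 1) (hc : ‖c‖ ≤ 1) (i : ℕ)
    (h : (p : ℝ)⁻¹ ^ p < ‖y ^ p ^ i - c ^ p ^ i‖ ^ (p - 1)) :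
    ‖y - c‖ ^ p ^ i = ‖y ^ p ^ i - c ^ p ^ i‖ := by
  have h0 := inv_prime_pos p
  induction i with
  | zero => simp
  | succ i ih =>
    have h1 : ‖y ^ p ^ i - c ^ p ^ i‖ ^ p = ‖y ^ p ^ (i + 1) - c ^ p ^ (i + 1)‖ := by
      rw [pow_succ, pow_mul, pow_mul]
      refine norm_sub_pow_prime_eq ?_ ?_ (by rwa [← pow_mul, ← pow_mul, ← pow_succ])
      · rw [norm_pow]; exact pow_le_one₀ (norm_nonneg _) hy
      · rw [norm_pow]; exact pow_le_one₀ (norm_nonneg _) hc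
    rw [← h1, pow_succ, pow_mul, ih]
    rw [← h1, ← pow_mul, mul_comm, pow_mul] at h
    have h2 := lt_of_pow_lt_pow_left₀ p (by positivity) h
    refine lt_of_le_of_lt ?_ h2
    exact pow_le_of_le_one h0.le (inv_prime_lt_one p).le hp.out.ne_zero

/-- `geomSum₂ p ω 1` vanishes, whereas it is nonzero on either side of the threshold. -/
theorem norm_primitiveRoot_sub_one {ω : C} (hω : IsPrimitiveRoot ω p) :
    ‖ω - 1‖ ^ (p - 1) = (p : ℝ)⁻¹ := by
  have h0 := inv_prime_pos p
  have hn : ‖ω‖ = 1 := by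
    have : ‖ω‖ ^ p = 1 := by rw [← norm_pow, hω.pow_eq_one, norm_one]
    exact (pow_eq_one_iff_of_nonneg (norm_nonneg _) hp.out.ne_zero).1 this
  have hF : geomSum₂ p ω 1 = 0 := by
    simpa [geomSum₂] using hω.geom_sum_eq_zero hp.out.one_lt
  rcases lt_trichotomy (‖ω - 1‖ ^ (p - 1)) (p : ℝ)⁻¹ with h | h | h
  · have := norm_geomSum₂_of_lt hn.le norm_one h
    rw [hF, norm_zero] at this
    exact absurd this h0.ne
  · exact h
  · have := norm_geomSum₂_of_gt hn.le norm_one.le h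
    rw [hF, norm_zero] at this
    rw [← this] at h
    exact absurd h (not_lt.2 h0.le)

end PAdic

/-! ### Roots at prescribed distance, and division by F = (Y^p - b^p)/(Y - b). -/

section Roots

variable {p : ℕ} [hp : Fact p.Prime] {C : Type*} [NormedField C] [NormedAlgebra ℚ_[p] C]
  [IsUltrametricDist C]

/-- If the coefficients have norms in the value group of `ℚ_[p]` and `ξ` has exponent `1 / e`, then
the terms of `∑ i < e, f i * ξ ^ i` have distinct norms. -/
theorem norm_le_of_norm_sum_mul_pow_le {ξ : C} {e N : ℕ} (hξ : ‖ξ‖ ^ e = (p : ℝ)⁻¹) {f : ℕ → C}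
    (hf : ∀ i < e, f i ≠ 0 → ∃ v : ℕ, ‖f i‖ = (p : ℝ)⁻¹ ^ v)
    (h : ‖∑ i ∈ range e, f i * ξ ^ i‖ ≤ (p : ℝ)⁻¹ ^ N) : ∀ i < e, ‖f i‖ ≤ (p : ℝ)⁻¹ ^ N := by
  have h0 := inv_prime_pos p
  have h1 := inv_prime_lt_one p
  have hterm : ∀ i < e, f i ≠ 0 → ∃ v : ℕ, ‖f i‖ = (p : ℝ)⁻¹ ^ v ∧
      ‖f i * ξ ^ i‖ ^ e = (p : ℝ)⁻¹ ^ (v * e + i) := fun i hie hi => by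
    obtain ⟨v, hv⟩ := hf i hie hi
    refine ⟨v, hv, ?_⟩
    rw [norm_mul, mul_pow, norm_pow, ← pow_mul, mul_comm i e, pow_mul, hξ, hv, ← pow_mul, ← pow_add]
  have key := norm_le_of_norm_sum_le (s := range e) (f := fun i => f i * ξ ^ i)
    (r := (p : ℝ)⁻¹ ^ N) ?_ (by positivity) h
  · intro i hie
    by_cases hi0 : f i = 0
    · rw [hi0, norm_zero]; positivity
    obtain ⟨v, hv, hv'⟩ := hterm i hie hi0
    have h2 := pow_le_pow_left₀ (norm_nonneg _) (key i (mem_range.2 hie)) e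
    rw [hv', ← pow_mul, pow_le_pow_iff_right_of_lt_one₀ h0 h1] at h2
    rw [hv, pow_le_pow_iff_right_of_lt_one₀ h0 h1]
    by_contra! h3
    have : (v + 1) * e ≤ N * e := Nat.mul_le_mul_right _ h3
    nlinarith
  · intro i hi j hj hfi hfj hij
    obtain ⟨v, -, hv⟩ := hterm i (mem_range.1 hi) (left_ne_zero_of_mul hfi)
    obtain ⟨w, -, hw⟩ := hterm j (mem_range.1 hj) (left_ne_zero_of_mul hfj)
    have h2 : v * e + i = w * e + j := pow_right_injective₀ h0 h1.ne (by
      show (p : ℝ)⁻¹ ^ (v * e + i) = (p : ℝ)⁻¹ ^ (w * e + j)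
      rw [← hv, ← hw]; exact congrArg (· ^ e) hij)
    -- The exponents v e + i determine i modulo e.
    have h3 := congrArg (· % e) h2
    simpa [Nat.add_mod, Nat.mod_eq_of_lt (mem_range.1 hi), Nat.mod_eq_of_lt (mem_range.1 hj)]
      using h3

theorem aeval_eq_sum_sub_pow {C : Type*} [CommRing C] (A : ℤ[X]) (η : C) (c : ℤ) {e : ℕ}
    (hA : A.natDegree < e) : aeval η A =
      ∑ i ∈ range e, (((A.comp (X + Polynomial.C c)).coeff i : ℤ) : C) * (η - c) ^ i := by
  conv_lhs => rw [show A = (A.comp (X + Polynomial.C c)).comp (X - Polynomial.C c) by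
    rw [comp_assoc]; simp]
  rw [aeval_comp, aeval_eq_sum_range' (n := e)]
  · simp [zsmul_eq_mul]
  · rwa [natDegree_comp, natDegree_X_add_C, mul_one]

theorem C_dvd_of_C_dvd_comp {A : ℤ[X]} {c d : ℤ}
    (h : Polynomial.C d ∣ A.comp (X + Polynomial.C c)) : Polynomial.C d ∣ A := by
  obtain ⟨D, hD⟩ := h
  refine ⟨D.comp (X - Polynomial.C c), ?_⟩
  calc A = (A.comp (X + Polynomial.C c)).comp (X - Polynomial.C c) := by rw [comp_assoc]; simp
    _ = _ := by rw [hD, mul_comp, C_comp]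

/-- Expand A in powers of η - c, which behaves as a uniformizer of ramification index e; integer
coefficients then give terms of distinct norms. -/
theorem C_pow_dvd_of_norm_aeval_le {η : C} {c : ℤ} {e N : ℕ}
    (hη : ‖η - c‖ ^ e = (p : ℝ)⁻¹) {A : ℤ[X]} (hA : A.natDegree < e)
    (h : ‖aeval η A‖ ≤ (p : ℝ)⁻¹ ^ N) : Polynomial.C ((p : ℤ) ^ N) ∣ A := by
  rw [aeval_eq_sum_sub_pow A η c hA] at h
  refine C_dvd_of_C_dvd_comp (c := c) ((C_dvd_iff_dvd_coeff _ _).2 fun i => ?_)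
  rcases lt_or_ge i e with hie | hie
  · exact norm_intCast_le_iff.1 (norm_le_of_norm_sum_mul_pow_le hη
      (fun i _ hi => exists_norm_intCast_eq_pow (fun h => hi (by rw [h, Int.cast_zero]))) h i hie)
  · rw [coeff_eq_zero_of_natDegree_lt]
    · exact dvd_zero _
    · rw [natDegree_comp, natDegree_X_add_C, mul_one]; omega

theorem norm_le_one_of_pow_eq {x y : C} {m : ℕ} (hm : m ≠ 0) (h : x ^ m = y) (hy : ‖y‖ ≤ 1) :
    ‖x‖ ≤ 1 := by
  by_contra! h'
  have := one_lt_pow₀ h' hm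
  rw [← norm_pow, h] at this
  exact absurd hy (not_le.2 this)

variable [IsAlgClosed C] [CharZero C]

theorem exists_isPrimitiveRoot (C : Type*) [Field C] [IsAlgClosed C] [CharZero C] (m : ℕ)
    (hm : m ≠ 0) : ∃ ω : C, IsPrimitiveRoot ω m := by
  have : NeZero ((m : ℕ) : C) := ⟨Nat.cast_ne_zero.2 hm⟩
  exact HasEnoughRootsOfUnity.exists_primitiveRoot C m

theorem prod_norm_sub_pow {X₀ c : C} : ∃ Y : C, Y ^ p = X₀ ∧
    ‖X₀ - c ^ p‖ = ∏ ζ ∈ nthRootsFinset p (1 : C), ‖ζ * Y - c‖ ∧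
      (nthRootsFinset p (1 : C)).card = p := by
  obtain ⟨Y, hY⟩ := IsAlgClosed.exists_pow_nat_eq X₀ hp.out.pos
  obtain ⟨ω, hω⟩ := exists_isPrimitiveRoot C p hp.out.ne_zero
  refine ⟨Y, hY, ?_, hω.card_nthRootsFinset⟩
  rw [norm_sub_rev, ← hY, hω.pow_sub_pow_eq_prod_sub_mul _ _ hp.out.pos, norm_prod]
  exact prod_congr rfl fun ζ _ => norm_sub_rev _ _

/-- ‖X₀ - c^p‖ is the product of the distances from c to the p roots, so the roots cannot all be
far. -/
theorem exists_root_norm_sub_lt {X₀ c : C}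
    (h : ‖X₀ - c ^ p‖ ^ (p - 1) < (p : ℝ)⁻¹ ^ p) :
    ∃ Y : C, Y ^ p = X₀ ∧ ‖Y - c‖ ^ (p - 1) < (p : ℝ)⁻¹ := by
  obtain ⟨Y, hY, hprod, hcard⟩ := prod_norm_sub_pow (p := p) (X₀ := X₀) (c := c)
  by_contra! hcon
  refine absurd h (not_lt.2 ?_)
  rw [hprod, ← prod_pow]
  rw [show (p : ℝ)⁻¹ ^ p = ∏ _ζ ∈ nthRootsFinset p (1 : C), (p : ℝ)⁻¹ by rw [prod_const, hcard]]
  refine prod_le_prod (fun _ _ => (inv_prime_pos p).le) fun ζ hζ => hcon _ ?_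
  rw [mul_pow, hY, (mem_nthRootsFinset hp.out.pos 1).1 hζ, one_mul]

theorem exists_root_norm_sub_eq {X₀ c : C} (hc : ‖c‖ = 1)
    (h : ‖X₀ - c ^ p‖ ^ (p - 1) ≤ (p : ℝ)⁻¹ ^ p) :
    ∃ Y : C, Y ^ p = X₀ ∧ ‖Y - c‖ ^ (p - 1) = (p : ℝ)⁻¹ := by
  have h0 := inv_prime_pos p
  have hle : ∃ Y : C, Y ^ p = X₀ ∧ ‖Y - c‖ ^ (p - 1) ≤ (p : ℝ)⁻¹ := by
    obtain ⟨Y, hY, hprod, hcard⟩ := prod_norm_sub_pow (p := p) (X₀ := X₀) (c := c)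
    by_contra! hcon
    refine absurd h (not_le.2 ?_)
    rw [hprod, ← prod_pow]
    rw [show (p : ℝ)⁻¹ ^ p = ∏ _ζ ∈ nthRootsFinset p (1 : C), (p : ℝ)⁻¹ by rw [prod_const, hcard]]
    refine prod_lt_prod_of_nonempty (fun _ _ => inv_prime_pos p) (fun ζ hζ => hcon _ ?_)
      (card_pos.1 (by rw [hcard]; exact hp.out.pos))
    rw [mul_pow, hY, (mem_nthRootsFinset hp.out.pos 1).1 hζ, one_mul]
  obtain ⟨Y, hY, hYc⟩ := hle
  rcases hYc.eq_or_lt with heq | hlt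
  · exact ⟨Y, hY, heq⟩
  obtain ⟨ω, hω⟩ := exists_isPrimitiveRoot C p hp.out.ne_zero
  have hY1 : ‖Y‖ = 1 := hc ▸ norm_eq_of_norm_sub_lt
    (hc ▸ norm_lt_one_of_pow_lt (hlt.trans (inv_prime_lt_one p)))
  have hω1 := norm_primitiveRoot_sub_one hω
  -- The root found is too near; rotating it by ω moves it to distance ‖ω - 1‖, exactly the
  -- threshold.
  refine ⟨ω * Y, by rw [mul_pow, hω.pow_eq_one, one_mul, hY], ?_⟩
  rw [← hω1, show ‖ω - 1‖ = ‖(ω - 1) * Y‖ by rw [norm_mul, hY1, mul_one]]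
  congr 1
  refine norm_eq_of_norm_sub_lt ?_
  rw [norm_mul, hY1, mul_one, show ω * Y - c - (ω - 1) * Y = Y - c by ring]
  exact lt_of_pow_lt_pow_left₀ (p - 1) (norm_nonneg _) (hω1 ▸ hlt)

theorem aeval_geomSum₂ (η : C) (s : ℕ) (b : ℤ) :
    aeval η (geomSum₂ p ((X : ℤ[X]) ^ p ^ s) (Polynomial.C b)) = geomSum₂ p (η ^ p ^ s) (b : C) := by
  simp [geomSum₂, map_sum]

theorem geomSum₂_X_pow_monic_natDegree (p m : ℕ) (hp : 0 < p) (hm : 0 < m) (b : ℤ) :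
    (geomSum₂ p ((X : ℤ[X]) ^ m) (Polynomial.C b)).Monic ∧
      (geomSum₂ p ((X : ℤ[X]) ^ m) (Polynomial.C b)).natDegree = m * (p - 1) := by
  have h1 : (geomSum₂ p ((X : ℤ[X]) ^ m) (Polynomial.C b)) * (X ^ m - Polynomial.C b)
      = X ^ (m * p) - Polynomial.C (b ^ p) := by
    rw [geomSum₂_mul, pow_mul, C_pow]
  have h2 := monic_X_pow_sub_C b hm.ne'
  have h3 := monic_X_pow_sub_C (b ^ p) (Nat.mul_pos hm hp).ne'
  have hM : (geomSum₂ p ((X : ℤ[X]) ^ m) (Polynomial.C b)).Monic :=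
    h2.of_mul_monic_right (h1 ▸ h3)
  refine ⟨hM, ?_⟩
  have h4 := congrArg natDegree h1
  rw [hM.natDegree_mul h2, natDegree_X_pow_sub_C, natDegree_X_pow_sub_C] at h4
  rw [Nat.mul_sub, mul_one]
  omega

/-- Take Y on the threshold and η above it. Then η - c has ramification exponent p^s (p - 1) = deg
F, so the remainder is governed by its value at η. That value is small because ‖F‖ ‖Y - b‖ = ‖X₀ -
b^p‖ ≤ p^(-(N+1)) and ‖Y - b‖ ≥ 1/p. -/
theorem C_pow_dvd_modByMonic {s N : ℕ} (hN : 1 ≤ N) {X₀ : C} {b c : ℤ} (hb : ¬ (p : ℤ) ∣ b)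
    (hX : ‖X₀ - (b : C) ^ p‖ ≤ (p : ℝ)⁻¹ ^ (N + 1))
    (hc : ‖(c : C) ^ p ^ s - b‖ ^ (p - 1) < (p : ℝ)⁻¹) {g : ℤ[X]}
    (hg : ∀ η : C, η ^ p ^ (s + 1) = X₀ → ‖aeval η g‖ ≤ (p : ℝ)⁻¹ ^ N) :
    Polynomial.C ((p : ℤ) ^ N) ∣ g %ₘ geomSum₂ p (X ^ p ^ s) (Polynomial.C b) := by
  have h0 := inv_prime_pos p
  have h1 := inv_prime_lt_one p
  have h2p := hp.out.two_le
  obtain ⟨hF, hFdeg⟩ := geomSum₂_X_pow_monic_natDegree p (p ^ s) hp.out.pos (pow_pos hp.out.pos s) b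
  have hb1 : ‖(b : C)‖ = 1 := norm_intCast_eq_one.2 hb
  obtain ⟨Y, hY, hYb⟩ := exists_root_norm_sub_eq (p := p) (X₀ := X₀) hb1 (by
    refine (pow_le_pow_left₀ (norm_nonneg _) hX _).trans ?_
    rw [← pow_mul]
    refine pow_le_pow_of_le_one h0.le h1.le ?_
    obtain ⟨q, rfl⟩ : ∃ q, p = q + 2 := ⟨p - 2, by omega⟩
    simp only [Nat.add_succ_sub_one]
    nlinarith)
  have hYb1 : ‖Y - b‖ < 1 := norm_lt_one_of_pow_lt (hYb ▸ h1)
  have hY1 : ‖Y‖ = 1 := hb1 ▸ norm_eq_of_norm_sub_lt (hb1 ▸ hYb1)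
  obtain ⟨η, hη⟩ := IsAlgClosed.exists_pow_nat_eq Y (pow_pos hp.out.pos s)
  have hη1 : ‖η‖ ≤ 1 := norm_le_one_of_pow_eq (pow_pos hp.out.pos s).ne' hη hY1.le
  have hc' : ‖η ^ p ^ s - (c : C) ^ p ^ s‖ = ‖Y - b‖ := by
    rw [hη]
    refine norm_eq_of_norm_sub_lt ?_
    rw [show Y - (c : C) ^ p ^ s - (Y - b) = -((c : C) ^ p ^ s - b) by ring, norm_neg]
    exact lt_of_pow_lt_pow_left₀ (p - 1) (norm_nonneg _) (hYb ▸ hc)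
  have hηc : ‖η - c‖ ^ p ^ s = ‖Y - b‖ := by
    rw [norm_sub_pow_prime_pow_eq (p := p) hη1 (norm_intCast_le_one' p c) s, hc']
    rw [hc', hYb]
    exact pow_lt_self_of_lt_one₀ h0 h1 hp.out.one_lt
  refine C_pow_dvd_of_norm_aeval_le (η := η) (c := c) (e := p ^ s * (p - 1)) ?_ ?_ ?_
  · rw [pow_mul, hηc, hYb]
  · rw [← hFdeg]
    refine natDegree_modByMonic_lt _ hF fun hone => ?_
    rw [hone, natDegree_one] at hFdeg
    have := Nat.mul_pos (pow_pos hp.out.pos s) (show 0 < p - 1 by omega)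
    omega
  · have hsplit : aeval η (g %ₘ geomSum₂ p (X ^ p ^ s) (Polynomial.C b)) = aeval η g -
        geomSum₂ p Y (b : C) * aeval η (g /ₘ geomSum₂ p (X ^ p ^ s) (Polynomial.C b)) := by
      rw [eq_sub_iff_add_eq, ← hη, ← aeval_geomSum₂, ← map_mul, ← map_add, modByMonic_add_div]
    rw [hsplit]
    refine norm_sub_le_of_le (hg η (by rw [pow_succ, pow_mul, hη, hY])) ?_
    rw [norm_mul]
    refine (mul_le_of_le_one_right (norm_nonneg _) (norm_aeval_le_one p _ hη1)).trans ?_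
    have hge : (p : ℝ)⁻¹ ≤ ‖Y - b‖ := by
      rw [← hYb]
      exact pow_le_of_le_one (norm_nonneg _) hYb1.le (by omega)
    have := geomSum₂_mul p Y (b : C)
    rw [hY] at this
    rw [← this, norm_mul, pow_succ] at hX
    exact le_of_mul_le_mul_right ((mul_le_mul_of_nonneg_left hge (norm_nonneg _)).trans hX) h0

/-- Strictly below the threshold F has norm exactly 1/p, so dividing by it costs one power of p. -/
theorem norm_aeval_divByMonic_le {s N : ℕ} {b : ℤ} (hb : ¬ (p : ℤ) ∣ b) {g : ℤ[X]}
    (hdvd : Polynomial.C ((p : ℤ) ^ (N + 1)) ∣ g %ₘ geomSum₂ p (X ^ p ^ s) (Polynomial.C b)) {η : C}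
    (hη : ‖η ^ p ^ s - b‖ ^ (p - 1) < (p : ℝ)⁻¹) (hg : ‖aeval η g‖ ≤ (p : ℝ)⁻¹ ^ (N + 1)) :
    ‖aeval η (g /ₘ geomSum₂ p (X ^ p ^ s) (Polynomial.C b))‖ ≤ (p : ℝ)⁻¹ ^ N := by
  have h0 := inv_prime_pos p
  have hb1 : ‖(b : C)‖ = 1 := norm_intCast_eq_one.2 hb
  have hY1 : ‖η ^ p ^ s‖ = 1 := hb1 ▸ norm_eq_of_norm_sub_lt
    (hb1 ▸ norm_lt_one_of_pow_lt (hη.trans (inv_prime_lt_one p)))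
  have hη1 : ‖η‖ ≤ 1 := norm_le_one_of_pow_eq (pow_pos hp.out.pos s).ne' rfl hY1.le
  have hF := norm_geomSum₂_of_lt hY1.le hb1 hη
  have hsplit : aeval η g - aeval η (g %ₘ geomSum₂ p (X ^ p ^ s) (Polynomial.C b)) =
      geomSum₂ p (η ^ p ^ s) (b : C) *
        aeval η (g /ₘ geomSum₂ p (X ^ p ^ s) (Polynomial.C b)) := by
    rw [sub_eq_iff_eq_add', ← aeval_geomSum₂, ← map_mul, ← map_add, modByMonic_add_div]
  have hA : ‖aeval η (g %ₘ geomSum₂ p (X ^ p ^ s) (Polynomial.C b))‖ ≤ (p : ℝ)⁻¹ ^ (N + 1) := by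
    obtain ⟨D, hD⟩ := hdvd
    rw [hD, map_mul, aeval_C, norm_mul]
    refine (mul_le_of_le_one_right (norm_nonneg _) (norm_aeval_le_one p _ hη1)).trans ?_
    simpa using (norm_intCast_le_iff (C := C) (z := (p : ℤ) ^ (N + 1)) (m := N + 1)).2 dvd_rfl
  have := norm_sub_le_of_le hg hA
  rw [hsplit, norm_mul, hF, pow_succ', mul_le_mul_iff_right₀ h0] at this
  exact this

end Roots

/-! ### The descent along the tower of p-th roots. -/

section Local

variable {p : ℕ} [hp : Fact p.Prime] {C : Type*} [NormedField C] [NormedAlgebra ℚ_[p] C]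
  [IsUltrametricDist C]

theorem norm_pow_sub_pow_le {x y : C} (hx : ‖x‖ ≤ 1) (hy : ‖y‖ ≤ 1) (m : ℕ) :
    ‖x ^ m - y ^ m‖ ≤ ‖x - y‖ := by
  rw [← geomSum₂_mul, norm_mul]
  refine mul_le_of_le_one_left (norm_nonneg _) ?_
  refine IsUltrametricDist.norm_sum_le_of_forall_le_of_nonneg zero_le_one fun i _ => ?_
  rw [norm_mul, norm_pow, norm_pow]
  exact mul_le_one₀ (pow_le_one₀ (norm_nonneg _) hx) (by positivity)
    (pow_le_one₀ (norm_nonneg _) hy)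

variable [IsAlgClosed C] [CharZero C]

/-- Descent along the tower: a statement on `p`-divisibility of polynomials of degree `< D` at the
roots of `η ^ p ^ t = X` with `X` near `B` lifts to degree `< p ^ (t + k) - p ^ t + D` at the roots
of `η ^ p ^ (t + k) = X₀` with `X₀` near `B ^ p ^ k`. -/
theorem prime_dvd_of_descent {t m D : ℕ} (hDm : D = 0 ∨ 1 ≤ m) {B c : ℤ} (hB : ¬ (p : ℤ) ∣ B)
    (hc : ‖(c : C) ^ p ^ t - B‖ ^ (p - 1) < (p : ℝ)⁻¹)
    (base : ∀ X₀ : C, ‖X₀ - B‖ ≤ (p : ℝ)⁻¹ ^ (m + 1) → ∀ q : ℤ[X],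
      (∀ η : C, η ^ p ^ t = X₀ → ‖aeval η q‖ ≤ (p : ℝ)⁻¹ ^ m) → q.natDegree < D →
        Polynomial.C (p : ℤ) ∣ q) (k : ℕ) :
    ∀ X₀ : C, ‖X₀ - (B : C) ^ p ^ k‖ ≤ (p : ℝ)⁻¹ ^ (k + m + 1) → ∀ g : ℤ[X],
      (∀ η : C, η ^ p ^ (t + k) = X₀ → ‖aeval η g‖ ≤ (p : ℝ)⁻¹ ^ (k + m)) →
        g.natDegree < p ^ (t + k) - p ^ t + D → Polynomial.C (p : ℤ) ∣ g := by
  have h0 := inv_prime_pos p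
  have h1 := inv_prime_lt_one p
  have h2p := hp.out.two_le
  induction k with
  | zero =>
    intro X₀ hX g hg hdeg
    exact base X₀ (by simpa using hX) g (by simpa using hg) (by simpa using hdeg)
  | succ k ih =>
    intro X₀ hX g hg hdeg
    set b : ℤ := B ^ p ^ k with hbdef
    have hb : ¬ (p : ℤ) ∣ b := fun h => hB ((Nat.prime_iff_prime_int.1 hp.out).dvd_of_dvd_pow h)
    have hb1 : ‖(b : C)‖ = 1 := norm_intCast_eq_one.2 hb
    have hX' : ‖X₀ - (b : C) ^ p‖ ≤ (p : ℝ)⁻¹ ^ (k + 1 + m + 1) := by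
      rwa [hbdef, Int.cast_pow, ← pow_mul, ← pow_succ]
    obtain ⟨hF, hFdeg⟩ := geomSum₂_X_pow_monic_natDegree p (p ^ (t + k)) hp.out.pos
      (pow_pos hp.out.pos _) b
    have hmod := C_pow_dvd_modByMonic (s := t + k) (c := c) (by omega) hb hX' (by
      refine lt_of_le_of_lt (pow_le_pow_left₀ (norm_nonneg _) ?_ _) hc
      rw [pow_add, pow_mul, hbdef, Int.cast_pow]
      refine norm_pow_sub_pow_le ?_ (norm_intCast_le_one' p B) _
      rw [norm_pow]
      exact pow_le_one₀ (norm_nonneg _) (norm_intCast_le_one' p c)) hg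
    set F := geomSum₂ p ((X : ℤ[X]) ^ p ^ (t + k)) (Polynomial.C b) with hFdef
    have hmod1 : Polynomial.C (p : ℤ) ∣ g %ₘ F :=
      (_root_.map_dvd Polynomial.C (dvd_pow_self (p : ℤ) (by omega))).trans hmod
    have hdvd : Polynomial.C (p : ℤ) ∣ g /ₘ F := by
      by_cases hlt : g.natDegree < F.natDegree
      · rw [(divByMonic_eq_zero_iff hF).2 (degree_lt_degree hlt)]
        exact dvd_zero _
      have hexp : p ^ (t + (k + 1)) = p ^ (t + k) * (p - 1) + p ^ (t + k) := by
        rw [← add_assoc, pow_succ]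
        conv_lhs => rw [show p = p - 1 + 1 by omega]
        rw [mul_add, mul_one, Nat.sub_add_cancel (by omega)]
      have htk : p ^ t ≤ p ^ (t + k) := Nat.pow_le_pow_right hp.out.pos (by omega)
      -- If k = m = 0 then D = 0 and the degree bound already gives deg g < deg F. For p = 2 the
      -- near root below needs k + m ≥ 1.
      have hkm : 1 ≤ k + m := by
        by_contra! hcon
        obtain ⟨rfl, rfl⟩ : k = 0 ∧ m = 0 := by omega
        obtain rfl : D = 0 := by omega
        simp only [add_zero] at *
        omega
      obtain ⟨Y, hY, hYb⟩ := exists_root_norm_sub_lt (p := p) (X₀ := X₀) (c := (b : C)) (by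
        refine lt_of_le_of_lt (pow_le_pow_left₀ (norm_nonneg _) hX' _) ?_
        rw [← pow_mul]
        refine pow_lt_pow_right_of_lt_one₀ h0 h1 ?_
        obtain ⟨q, rfl⟩ : ∃ q, p = q + 2 := ⟨p - 2, by omega⟩
        simp only [Nat.add_succ_sub_one]
        nlinarith)
      have hY1 : ‖Y‖ = 1 := hb1 ▸ norm_eq_of_norm_sub_lt
        (hb1 ▸ norm_lt_one_of_pow_lt (hYb.trans h1))
      refine ih Y ?_ _ (fun η hη => ?_) ?_
      · have h3 := geomSum₂_mul p Y (b : C)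
        rw [hY] at h3
        rw [← h3, norm_mul, norm_geomSum₂_of_lt hY1.le hb1 hYb,
          show k + 1 + m + 1 = (k + m + 1) + 1 by ring, pow_succ', mul_le_mul_iff_right₀ h0] at hX'
        rwa [hbdef, Int.cast_pow] at hX'
      · refine norm_aeval_divByMonic_le hb ?_ (by rwa [hη]) ?_
        · rwa [show k + m + 1 = k + 1 + m by ring]
        · rw [show k + m + 1 = k + 1 + m by ring]
          exact hg η (by rw [← add_assoc, pow_succ, pow_mul, hη, hY])
      · rw [natDegree_divByMonic _ hF, hFdeg]
        rw [hFdeg] at hlt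
        omega
    rw [← modByMonic_add_div g F]
    exact dvd_add hmod1 (dvd_mul_of_dvd_right hdvd _)

/-- p - 1 divides p^i - 1. -/
theorem pow_dvd_pow_prime_pow_sub {a : ℤ} {m : ℕ} (h : (p : ℤ) ^ m ∣ a ^ (p - 1) - 1) (i : ℕ) :
    (p : ℤ) ^ m ∣ a ^ p ^ i - a := by
  have h1 : a ^ (p - 1) - 1 ∣ a ^ (p ^ i - 1) - 1 := by
    obtain ⟨w, hw⟩ := Nat.sub_one_dvd_pow_sub_one (x := p) (n := i)
    rw [hw, pow_mul]
    simpa using sub_dvd_pow_sub_pow (a ^ (p - 1)) 1 w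
  have h2 : a ^ p ^ i - a = (a ^ (p ^ i - 1) - 1) * a := by
    rw [sub_mul, ← pow_succ, Nat.sub_add_cancel (Nat.one_le_pow _ _ hp.out.pos), one_mul]
  rw [h2]
  exact dvd_mul_of_dvd_left (h.trans h1) _

/-- Descent with D = 0, so that the base is vacuous; B = a^(p^t) works since a^(p^s) ≡ a mod
p^(k+1). -/
theorem prime_dvd_of_natDegree_lt {a : ℤ} (ha : ¬ (p : ℤ) ∣ a) {s k : ℕ} (hks : k ≤ s)
    (hr : (p : ℤ) ^ (k + 1) ∣ a ^ (p - 1) - 1) {g : ℤ[X]}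
    (hg : ∀ η : C, η ^ p ^ s = a → ‖aeval η g‖ ≤ (p : ℝ)⁻¹ ^ k)
    (hdeg : g.natDegree < p ^ s - p ^ (s - k)) : Polynomial.C (p : ℤ) ∣ g := by
  obtain ⟨t, rfl⟩ : ∃ t, s = t + k := ⟨s - k, by omega⟩
  refine prime_dvd_of_descent (C := C) (t := t) (m := 0) (D := 0) (Or.inl rfl) (B := a ^ p ^ t)
    (c := a) (fun h => ha ((Nat.prime_iff_prime_int.1 hp.out).dvd_of_dvd_pow h)) ?_
    (fun _ _ _ _ h => absurd h (Nat.not_lt_zero _)) k a ?_ g (by simpa using hg)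
    (by simpa using hdeg)
  · have := hp.out.two_le
    simp [show p - 1 ≠ 0 by omega, hp.out.pos]
  · have := (norm_intCast_le_iff (C := C)).2 (pow_dvd_pow_prime_pow_sub hr (t + k))
    rw [norm_sub_rev, Int.cast_pow, ← pow_mul, ← pow_add]
    simpa using this

end Local

/-! ### Approximating a by p-power powers of integers. -/

section Arithmetic

variable {p : ℕ} [hp : Fact p.Prime]

theorem pow_dvd_pow_pow_sub_one {x : ℤ} {m : ℕ} (hm : 1 ≤ m) (h : (p : ℤ) ^ m ∣ x - 1) (i : ℕ) :
    (p : ℤ) ^ (m + i) ∣ x ^ p ^ i - 1 := by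
  induction i with
  | zero => simpa using h
  | succ i ih =>
    have hx : (p : ℤ) ∣ x ^ p ^ i - 1 := (dvd_pow_self _ (by omega)).trans ih
    rw [pow_succ p, pow_mul, show (x ^ p ^ i) ^ p - 1 = _ from (geom_sum_mul (x ^ p ^ i) p).symm, ← add_assoc, pow_succ']
    refine mul_dvd_mul ?_ ih
    have : ∀ j ∈ range p, (p : ℤ) ∣ (x ^ p ^ i) ^ j - 1 := fun j _ =>
      hx.trans (sub_one_dvd_pow_sub_one _ _)
    have h2 := dvd_sum this
    rw [sum_sub_distrib] at h2
    simpa using h2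

theorem dvd_pow_sub_one_sub_one {a : ℤ} (ha : ¬ (p : ℤ) ∣ a) : (p : ℤ) ∣ a ^ (p - 1) - 1 :=
  (Int.ModEq.pow_card_sub_one_eq_one hp.out
    (((Nat.prime_iff_prime_int.1 hp.out).coprime_iff_not_dvd.2 ha).symm)).symm.dvd

/-- For odd p the units mod p^(r+2) are cyclic of order p^(r+1) (p - 1); since a^((p-1)p) = 1 there,
a is a p^r-th power. -/
theorem exists_pow_prime_pow_modEq (h2 : p ≠ 2) {a : ℤ} (ha : ¬ (p : ℤ) ∣ a) {r : ℕ}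
    (h : (p : ℤ) ^ (r + 1) ∣ a ^ (p - 1) - 1) : ∃ B : ℤ, (p : ℤ) ^ (r + 2) ∣ B ^ p ^ r - a := by
  have hcyc := ZMod.isCyclic_units_of_prime_pow p hp.out h2 (r + 2)
  have hco : IsCoprime a ((p ^ (r + 2) : ℕ) : ℤ) := by
    push_cast
    exact (((Nat.prime_iff_prime_int.1 hp.out).coprime_iff_not_dvd.2 ha).symm).pow_right
  obtain ⟨g, hg⟩ := hcyc.exists_generator
  let u : (ZMod (p ^ (r + 2)))ˣ := ZMod.unitOfIsCoprime a hco
  have hu : (u : ZMod (p ^ (r + 2))) = a := ZMod.coe_unitOfIsCoprime a hco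
  obtain ⟨i, hi⟩ := Submonoid.mem_powers_iff _ _ |>.1 (mem_powers_iff_mem_zpowers.2 (hg u))
  have hu1 : u ^ ((p - 1) * p) = 1 := by
    ext
    rw [Units.val_pow_eq_pow_val, hu, Units.val_one]
    have h3 := pow_dvd_pow_pow_sub_one (by omega) h 1
    rw [pow_one, ← pow_mul] at h3
    have h4 := (ZMod.intCast_zmod_eq_zero_iff_dvd _ (p ^ (r + 2))).2
      (by push_cast; exact h3)
    push_cast at h4
    exact sub_eq_zero.1 h4
  have hord : orderOf g = p ^ (r + 1) * (p - 1) := by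
    rw [orderOf_eq_card_of_forall_mem_zpowers hg, Nat.card_eq_fintype_card,
      ZMod.card_units_eq_totient, Nat.totient_prime_pow hp.out (by omega)]
    congr 1
  rw [← hi, ← pow_mul] at hu1
  have hdvd := orderOf_dvd_of_pow_eq_one hu1
  rw [hord] at hdvd
  have hpr : p ^ r ∣ i := by
    have hpos : 0 < p * (p - 1) := Nat.mul_pos hp.out.pos (by have := hp.out.two_le; omega)
    refine Nat.dvd_of_mul_dvd_mul_right hpos ?_
    convert hdvd using 1 <;> ring
  obtain ⟨w, rfl⟩ := hpr
  obtain ⟨B, hB⟩ := ZMod.intCast_surjective ((g ^ w : (ZMod (p ^ (r + 2)))ˣ) : ZMod (p ^ (r + 2)))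
  refine ⟨B, ?_⟩
  have h5 : ((B ^ p ^ r - a : ℤ) : ZMod (p ^ (r + 2))) = 0 := by
    push_cast
    rw [hB, ← hu, ← hi, sub_eq_zero, ← Units.val_pow_eq_pow_val, ← pow_mul, mul_comm]
  have h6 := (ZMod.intCast_zmod_eq_zero_iff_dvd _ (p ^ (r + 2))).1 h5
  exact_mod_cast h6

/-- Substitute for cyclicity when p = 2: powers of 5 realise each exact 2-power in a - 1 from 4 on.
-/
theorem exists_five_pow_eq (i : ℕ) : ∃ u : ℤ, 5 ^ 2 ^ i = 1 + 2 ^ (i + 2) * (2 * u + 1) := by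
  induction i with
  | zero => exact ⟨0, by norm_num⟩
  | succ i ih =>
    obtain ⟨u, hu⟩ := ih
    refine ⟨u + 2 ^ i * (2 * u + 1) ^ 2, ?_⟩
    rw [pow_succ, pow_mul, hu]
    ring

end Arithmetic

/-! ### Base of the descent: a totally ramified layer. -/

section Ramified

variable {p : ℕ} [hp : Fact p.Prime] {C : Type*} [NormedField C] [NormedAlgebra ℚ_[p] C]
  [IsUltrametricDist C] [IsAlgClosed C]

/-- The totally ramified case. -/
theorem prime_dvd_of_near {B : ℤ} (hB : ¬ (p : ℤ) ∣ B)
    (hB2 : ¬ (p : ℤ) ^ 2 ∣ B ^ (p - 1) - 1) {t : ℕ} (ht : 1 ≤ t) {X₀ : C}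
    (hX : ‖X₀ - B‖ ≤ (p : ℝ)⁻¹ ^ 2) {q : ℤ[X]}
    (hq : ∀ η : C, η ^ p ^ t = X₀ → ‖aeval η q‖ ≤ (p : ℝ)⁻¹) (hdeg : q.natDegree < p ^ t) :
    Polynomial.C (p : ℤ) ∣ q := by
  have h0 := inv_prime_pos p
  have h1 := inv_prime_lt_one p
  have hBn : ‖(B : C)‖ = 1 := norm_intCast_eq_one.2 hB
  have hpp := Nat.prime_iff_prime_int.1 hp.out
  have hX1 : ‖X₀‖ = 1 := hBn ▸ norm_eq_of_norm_sub_lt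
    (hBn ▸ hX.trans_lt (pow_lt_one₀ h0.le h1 two_ne_zero))
  -- Modulo p² one has B^(p^t) ≡ B^p, which differs from B by hypothesis. Hence (η - B)^(p^t) will
  -- have norm 1/p.
  have hdiff : ‖((B ^ p ^ t - B : ℤ) : C)‖ = (p : ℝ)⁻¹ := by
    rw [← pow_one (p : ℝ)⁻¹]
    refine norm_intCast_eq_pow ?_ fun h => hB2 ?_
    · exact pow_dvd_pow_prime_pow_sub (by simpa using dvd_pow_sub_one_sub_one hB) t
    · obtain ⟨t, rfl⟩ : ∃ t', t = t' + 1 := ⟨t - 1, by omega⟩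
      have h3 : (p : ℤ) ^ 2 ∣ (B ^ p ^ t) ^ p ^ 1 - B ^ p ^ 1 :=
        dvd_sub_pow_of_dvd_sub (by
          simpa using pow_dvd_pow_prime_pow_sub (m := 1) (by simpa using dvd_pow_sub_one_sub_one hB) t) 1
      rw [pow_one, ← pow_mul, ← pow_succ] at h3
      have h4 := dvd_sub h h3
      have h5 : B ^ p ^ (t + 1) - B - (B ^ p ^ (t + 1) - B ^ p) = (B ^ (p - 1) - 1) * B := by
        rw [sub_mul, ← pow_succ, Nat.sub_add_cancel hp.out.one_le]; ring
      rw [h5] at h4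
      exact (IsCoprime.pow_left (hpp.coprime_iff_not_dvd.2 hB)).dvd_of_dvd_mul_right h4
  obtain ⟨η, hη⟩ := IsAlgClosed.exists_pow_nat_eq X₀ (pow_pos hp.out.pos t)
  have hη1 := norm_le_one_of_pow_eq (pow_pos hp.out.pos t).ne' hη hX1.le
  have hnorm : ‖η ^ p ^ t - (B : C) ^ p ^ t‖ = (p : ℝ)⁻¹ := by
    rw [hη, ← hdiff, ← norm_neg ((B ^ p ^ t - B : ℤ) : C)]
    refine norm_eq_of_norm_sub_lt ?_
    rw [norm_neg, hdiff]
    refine lt_of_le_of_lt ?_ (pow_lt_self_of_lt_one₀ h0 h1 one_lt_two)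
    have e : X₀ - (B : C) ^ p ^ t - -((B ^ p ^ t - B : ℤ) : C) = X₀ - B := by push_cast; ring
    rwa [e]
  have := C_pow_dvd_of_norm_aeval_le (p := p) (η := η) (c := B) (e := p ^ t) (N := 1) (A := q) ?_
    hdeg (by simpa using hq η hη)
  · simpa using this
  · rw [norm_sub_pow_prime_pow_eq (p := p) hη1 hBn.le, hnorm]
    rw [hnorm]
    exact pow_lt_pow_right_of_lt_one₀ h0 h1 (by have := hp.out.pos; omega)

end Ramified

/-! ### Base of the descent for p = 2: radicand near 5. -/

section Dyadic

variable {C : Type*} [NormedField C] [NormedAlgebra ℚ_[2] C] [IsUltrametricDist C]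

/-- Multiply by the approximate conjugate u + w(-1 - τ): the product is close to the norm form u² -
uw - w², which is odd unless u and w are both even. Thus τ generates an unramified quadratic
extension. -/
theorem norm_add_mul_eq_one {τ : C} (hτ : ‖τ‖ ≤ 1) (h : ‖τ ^ 2 + τ - 1‖ ≤ 2⁻¹) {u w : ℤ}
    (huw : ¬ (2 ∣ u ∧ 2 ∣ w)) : ‖(u : C) + w * τ‖ = 1 := by
  have hu : ‖(u : C)‖ ≤ 1 := norm_intCast_le_one' 2 u
  have hw : ‖(w : C)‖ ≤ 1 := norm_intCast_le_one' 2 w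
  have hle : ∀ σ : C, ‖σ‖ ≤ 1 → ‖(u : C) + w * σ‖ ≤ 1 := fun σ hσ =>
    norm_add_le_of_le hu (by rw [norm_mul]; exact mul_le_one₀ hw (norm_nonneg _) hσ)
  have h1 := hle τ hτ
  have h2 := hle (-1 - τ) (norm_sub_le_of_le (by simp) hτ)
  have hodd : ¬ (2 : ℤ) ∣ u ^ 2 - u * w - w ^ 2 := by
    rw [← even_iff_two_dvd, ← even_iff_two_dvd] at huw
    rw [← even_iff_two_dvd, Int.even_sub, Int.even_sub, Int.even_mul, Int.even_pow' two_ne_zero,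
      Int.even_pow' two_ne_zero]
    tauto
  have h3 : ‖((u ^ 2 - u * w - w ^ 2 : ℤ) : C)‖ = 1 :=
    (norm_intCast_eq_one (p := 2)).2 (by exact_mod_cast hodd)
  have h4 : ‖((u : C) + w * τ) * ((u : C) + w * (-1 - τ))‖ = 1 := by
    rw [← h3]
    refine norm_eq_of_norm_sub_lt ?_
    rw [h3]
    have : ((u : C) + w * τ) * ((u : C) + w * (-1 - τ)) - ((u ^ 2 - u * w - w ^ 2 : ℤ) : C)
        = -(w ^ 2 * (τ ^ 2 + τ - 1)) := by push_cast; ring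
    rw [this, norm_neg, norm_mul, norm_pow]
    calc _ ≤ 1 * (2⁻¹ : ℝ) := by gcongr; exact pow_le_one₀ (norm_nonneg _) hw
      _ < 1 := by norm_num
  rw [norm_mul] at h4
  nlinarith [norm_nonneg ((u : C) + w * τ), norm_nonneg ((u : C) + w * (-1 - τ))]

theorem exists_norm_add_mul_eq {τ : C} (hτ : ‖τ‖ ≤ 1) (h : ‖τ ^ 2 + τ - 1‖ ≤ 2⁻¹) {u w : ℤ}
    (huw : ¬ (u = 0 ∧ w = 0)) :
    ∃ v : ℕ, ‖(u : C) + w * τ‖ = (2 : ℝ)⁻¹ ^ v ∧ (2 : ℤ) ^ v ∣ u ∧ (2 : ℤ) ^ v ∣ w := by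
  have hg : Int.gcd u w ≠ 0 := fun h => huw (Int.gcd_eq_zero_iff.1 h)
  obtain ⟨g, u', w', hgpos, hco, hu, hw⟩ := Int.exists_gcd_one' (Nat.pos_of_ne_zero hg)
  obtain ⟨v, hv⟩ := exists_norm_intCast_eq_pow (p := 2) (C := C) (z := g)
    (by exact_mod_cast hgpos.ne')
  rw [Nat.cast_ofNat] at hv
  have hvg : (2 : ℤ) ^ v ∣ g := by
    exact_mod_cast (norm_intCast_le_iff (p := 2) (C := C) (z := g) (m := v)).1
      (by rw [hv, Nat.cast_ofNat])
  refine ⟨v, ?_, hu ▸ dvd_mul_of_dvd_right hvg _, hw ▸ dvd_mul_of_dvd_right hvg _⟩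
  have : (u : C) + w * τ = (g : ℤ) * ((u' : C) + w' * τ) := by rw [hu, hw]; push_cast; ring
  rw [this, norm_mul, hv, norm_add_mul_eq_one hτ h, mul_one]
  rintro ⟨h1, h2⟩
  have := Int.dvd_coe_gcd h1 h2
  rw [hco] at this
  norm_num at this

variable [IsAlgClosed C]

/-- A square root μ of X₀ is 1 + 2τ with τ unramified quadratic, and η - 1 is totally ramified above
it. Write q = q₀ + X^(2^t) q₁ and expand both parts in powers of η - 1, with coefficients in ℤ + ℤτ.
-/
theorem two_dvd_of_near {t : ℕ} (ht : 1 ≤ t) {X₀ : C} (hX : ‖X₀ - 5‖ ≤ (2 : ℝ)⁻¹ ^ 3) {q : ℤ[X]}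
    (hq : ∀ η : C, η ^ 2 ^ t = X₀ → ‖aeval η q‖ ≤ (2 : ℝ)⁻¹ ^ 2) (hdeg : q.natDegree < 2 ^ t) :
    Polynomial.C (2 : ℤ) ∣ q := by
  obtain ⟨t, rfl⟩ : ∃ t', t = t' + 1 := ⟨t - 1, by omega⟩
  have hchar : (2 : C) ≠ 0 := by
    intro h
    have := norm_prime 2 C
    rw [Nat.cast_ofNat, h, norm_zero] at this
    norm_num at this
  have hn2 : ‖(2 : C)‖ = 2⁻¹ := by simpa using norm_prime 2 C
  obtain ⟨η, hη⟩ := IsAlgClosed.exists_pow_nat_eq X₀ (pow_pos two_pos (t + 1))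
  set μ := η ^ 2 ^ t with hμ
  have hμ2 : μ ^ 2 = X₀ := by rw [hμ, ← pow_mul, ← pow_succ, hη]
  set τ := (μ - 1) / 2 with hτdef
  have hμτ : μ = 1 + 2 * τ := by rw [hτdef]; field_simp; ring
  have hτ2 : ‖τ ^ 2 + τ - 1‖ ≤ 2⁻¹ := by
    have : X₀ - 5 = 2 ^ 2 * (τ ^ 2 + τ - 1) := by rw [← hμ2, hμτ]; ring
    rw [this, norm_mul, norm_pow, hn2] at hX
    linarith
  have hτ1 : ‖τ‖ ≤ 1 := by
    by_contra! hcon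
    have h1 : ‖τ * (τ + 1)‖ ≤ 1 := by
      rw [show τ * (τ + 1) = (τ ^ 2 + τ - 1) + 1 by ring]
      exact norm_add_le_of_le (hτ2.trans (by norm_num)) (by simp)
    have h2 : ‖τ + 1‖ = ‖τ‖ := norm_eq_of_norm_sub_lt (by simpa using hcon)
    rw [norm_mul, h2] at h1
    nlinarith
  have hτn : ‖τ‖ = 1 := by
    simpa using norm_add_mul_eq_one hτ1 hτ2 (u := 0) (w := 1) (by norm_num)
  have hμn : ‖μ - 1‖ = 2⁻¹ := by
    rw [hμτ, add_sub_cancel_left, norm_mul, hn2, hτn, mul_one]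
  have hμ1 : ‖μ‖ ≤ 1 := by
    rw [show μ = (μ - 1) + 1 by ring]
    exact norm_add_le_of_le (hμn.le.trans (by norm_num)) (by simp)
  have hη1 : ‖η‖ ≤ 1 := norm_le_one_of_pow_eq (pow_pos two_pos t).ne' hμ.symm hμ1
  have hξ : ‖η - (1 : ℤ)‖ ^ 2 ^ t = ((2 : ℕ) : ℝ)⁻¹ := by
    have hh : ‖η ^ 2 ^ t - ((1 : ℤ) : C) ^ 2 ^ t‖ = 2⁻¹ := by simpa [← hμ] using hμn
    rw [norm_sub_pow_prime_pow_eq (p := 2) hη1 (by simp), hh]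
    · norm_num
    · rw [hh]; norm_num
  have hPmonic : (X ^ 2 ^ t : ℤ[X]).Monic := monic_X_pow _
  have h2t : 0 < 2 ^ t := pow_pos two_pos t
  set q₀ := q %ₘ X ^ 2 ^ t with hq0
  set q₁ := q /ₘ X ^ 2 ^ t with hq1
  have hq0d : q₀.natDegree < 2 ^ t := by
    have := natDegree_modByMonic_lt q hPmonic (fun h => by
      have := congrArg natDegree h
      rw [natDegree_X_pow, natDegree_one] at this
      omega)
    rwa [natDegree_X_pow] at this
  have hq1d : q₁.natDegree < 2 ^ t := by
    rw [hq1, natDegree_divByMonic _ hPmonic, natDegree_X_pow]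
    rw [pow_succ] at hdeg
    omega
  set c := fun i => (q₀.comp (X + Polynomial.C 1)).coeff i with hc
  set d := fun i => (q₁.comp (X + Polynomial.C 1)).coeff i with hd
  have hsum : aeval η q = ∑ i ∈ range (2 ^ t), (((c i + d i : ℤ) : C) + ((2 * d i : ℤ) : C) * τ)
      * (η - (1 : ℤ)) ^ i := by
    rw [← modByMonic_add_div q (X ^ 2 ^ t), ← hq0, ← hq1, map_add, map_mul, map_pow, aeval_X, ← hμ,
      aeval_eq_sum_sub_pow q₀ η 1 hq0d, aeval_eq_sum_sub_pow q₁ η 1 hq1d, mul_sum,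
      ← sum_add_distrib]
    refine sum_congr rfl fun i _ => ?_
    rw [hμτ]
    push_cast
    ring
  have hb := hq η hη
  rw [hsum] at hb
  have key := norm_le_of_norm_sum_mul_pow_le (p := 2) hξ (N := 2)
    (f := fun i => ((c i + d i : ℤ) : C) + ((2 * d i : ℤ) : C) * τ) ?_ (by simpa using hb)
  -- From 4 ∣ c + d and 4 ∣ 2d only 2 ∣ c and 2 ∣ d follow. The factor 2 in μ = 1 + 2τ is why the
  -- bound must be 2^(-2).
  · have hcd : ∀ i < 2 ^ t, 2 ∣ c i ∧ 2 ∣ d i := by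
      intro i hi
      by_cases h0 : c i + d i = 0 ∧ 2 * d i = 0
      · obtain ⟨h1, h2⟩ := h0
        have : d i = 0 := by omega
        have : c i = 0 := by omega
        rw [‹d i = 0›, ‹c i = 0›]
        exact ⟨dvd_zero _, dvd_zero _⟩
      obtain ⟨v, hv, hv1, hv2⟩ := exists_norm_add_mul_eq hτ1 hτ2 h0
      have hk := key i hi
      rw [hv, Nat.cast_ofNat, pow_le_pow_iff_right_of_lt_one₀ (by norm_num) (by norm_num)] at hk
      have h41 := (pow_dvd_pow (2 : ℤ) hk).trans hv1
      have h42 := (pow_dvd_pow (2 : ℤ) hk).trans hv2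
      omega
    have hdvd : ∀ r : ℤ[X], r.natDegree < 2 ^ t →
        (∀ i < 2 ^ t, 2 ∣ (r.comp (X + Polynomial.C 1)).coeff i) → Polynomial.C (2 : ℤ) ∣ r := by
      intro r hr h
      refine C_dvd_of_C_dvd_comp (c := 1) ((C_dvd_iff_dvd_coeff _ _).2 fun i => ?_)
      rcases lt_or_ge i (2 ^ t) with hi | hi
      · exact h i hi
      · rw [coeff_eq_zero_of_natDegree_lt]
        · exact dvd_zero _
        · rw [natDegree_comp, natDegree_X_add_C, mul_one]; omega
    rw [← modByMonic_add_div q (X ^ 2 ^ t)]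
    exact dvd_add (hdvd _ hq0d fun i hi => (hcd i hi).1)
      (dvd_mul_of_dvd_right (hdvd _ hq1d fun i hi => (hcd i hi).2) _)
  · intro i _ hne
    obtain ⟨v, hv, -⟩ := exists_norm_add_mul_eq hτ1 hτ2 (u := c i + d i) (w := 2 * d i)
      (fun h => hne (by rw [h.1, h.2]; simp))
    exact ⟨v, by rw [hv]; norm_num⟩

end Dyadic

/-! ### Averaging over roots of unity. -/

section Averaging

theorem sum_range_mul_filter {R : Type*} [AddCommMonoid R] (N M i : ℕ) (hi : i < N) (f : ℕ → R) :
    ∑ t ∈ (range (N * M)).filter (fun t => t % N = i), f t = ∑ l ∈ range M, f (i + N * l) := by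
  symm
  refine sum_nbij' (fun l => i + N * l) (fun t => t / N) ?_ ?_ ?_ ?_ (fun _ _ => rfl)
  · intro l hl
    have := mem_range.1 hl
    simp only [mem_filter, mem_range, Nat.add_mul_mod_self_left, Nat.mod_eq_of_lt hi, and_true]
    nlinarith
  · intro t ht
    simp only [mem_filter, mem_range] at ht ⊢
    exact Nat.div_lt_of_lt_mul ht.1
  · intro l _
    rw [Nat.add_mul_div_left _ _ (by omega), Nat.div_eq_of_lt hi, zero_add]
  · intro t ht
    simp only [mem_filter, mem_range] at ht ⊢
    rw [← ht.2, Nat.mod_add_div]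

/-- Orthogonality of N-th roots of unity isolates the exponents congruent to i mod N; the price is
the factor N. -/
theorem sum_inv_pow_mul_eval {C : Type*} [Field C] {N M i : ℕ} (hi : i < N) {ζ : C}
    (hζ : IsPrimitiveRoot ζ N) {h : C[X]} (hdeg : h.natDegree < N * M) (y : C) :
    ∑ j ∈ range N, (ζ⁻¹) ^ (j * i) * h.eval (ζ ^ j * y) =
      N * ∑ l ∈ range M, h.coeff (i + N * l) * y ^ (i + N * l) := by
  have hζ0 : ζ ≠ 0 := hζ.ne_zero (by omega)
  have hinner : ∀ t, ∑ j ∈ range N, (ζ⁻¹) ^ (j * i) * (ζ ^ j) ^ t =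
      if t % N = i then (N : C) else 0 := by
    intro t
    have h1 : ∀ j ∈ range N, (ζ⁻¹) ^ (j * i) * (ζ ^ j) ^ t = (ζ ^ t / ζ ^ i) ^ j := fun j _ => by
      rw [div_eq_mul_inv, mul_pow, ← pow_mul, ← pow_mul, ← inv_pow, ← pow_mul, mul_comm, mul_comm j t,
        mul_comm j i]
    rw [sum_congr rfl h1]
    split_ifs with h
    · have : ζ ^ t = ζ ^ i := by
        rw [← h, ← pow_mod_orderOf ζ t, hζ.eq_orderOf.symm]
      rw [this, div_self (pow_ne_zero _ hζ0)]
      simp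
    · have hne : ζ ^ t / ζ ^ i - 1 ≠ 0 := by
        intro h0
        rw [sub_eq_zero, div_eq_one_iff_eq (pow_ne_zero _ hζ0), ← pow_mod_orderOf ζ t,
          hζ.eq_orderOf.symm] at h0
        exact h (hζ.pow_inj (Nat.mod_lt _ (by omega)) hi h0)
      refine (mul_eq_zero.1 ?_).resolve_right hne
      rw [geom_sum_mul, div_pow, ← pow_mul, ← pow_mul, mul_comm t, mul_comm i, pow_mul, pow_mul,
        hζ.pow_eq_one]
      simp
  calc _ = ∑ j ∈ range N, ∑ t ∈ range (N * M), h.coeff t * y ^ t * ((ζ⁻¹) ^ (j * i) * (ζ ^ j) ^ t) := by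
        refine sum_congr rfl fun j _ => ?_
        rw [eval_eq_sum_range' hdeg, mul_sum]
        refine sum_congr rfl fun t _ => ?_
        rw [mul_pow]; ring
    _ = ∑ t ∈ range (N * M), if t % N = i then h.coeff t * y ^ t * N else 0 := by
        rw [sum_comm]
        refine sum_congr rfl fun t _ => ?_
        rw [← mul_sum, hinner, mul_ite, mul_zero]
    _ = _ := by
        rw [← sum_filter, sum_range_mul_filter N M i hi, mul_sum]
        exact sum_congr rfl fun l _ => by ring

variable {p : ℕ} [hp : Fact p.Prime] {C : Type*} [NormedField C] [NormedAlgebra ℚ_[p] C]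
  [IsUltrametricDist C] [IsAlgClosed C] [CharZero C]

theorem norm_mul_sum_coeff_le {N M i : ℕ} (hi : i < N) {h : C[X]} (hdeg : h.natDegree < N * M)
    {x y : C} (hy : y ^ (N * M) = x) {R : ℝ} (hR : 0 ≤ R)
    (hh : ∀ z : C, z ^ (N * M) = x → ‖h.eval z‖ ≤ R) :
    ‖(N : C) * ∑ l ∈ range M, h.coeff (i + N * l) * y ^ (i + N * l)‖ ≤ R := by
  obtain ⟨ζ, hζ⟩ := exists_isPrimitiveRoot C N (by omega)
  rw [← sum_inv_pow_mul_eval hi hζ hdeg y]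
  refine IsUltrametricDist.norm_sum_le_of_forall_le_of_nonneg hR fun j _ => ?_
  have hζ1 : ‖ζ‖ = 1 := by
    have : ‖ζ‖ ^ N = 1 := by rw [← norm_pow, hζ.pow_eq_one, norm_one]
    exact (pow_eq_one_iff_of_nonneg (norm_nonneg _) (by omega)).1 this
  rw [norm_mul, norm_pow, norm_inv, hζ1, inv_one, one_pow, one_mul]
  refine hh _ ?_
  rw [mul_pow, ← pow_mul, mul_comm j, mul_assoc, mul_comm M j, pow_mul, hζ.pow_eq_one, one_pow,
    one_mul, hy]

end Averaging

/-! ### Divisibility of polynomials small at all p^s-th roots of a. -/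

section LocalBound

variable {p : ℕ} [hp : Fact p.Prime] {C : Type*} [NormedField C] [NormedAlgebra ℚ_[p] C]
  [IsUltrametricDist C] [IsAlgClosed C] [CharZero C]

/-- For r > 0, approximate a mod p^(r+2) and descend to a ramified or dyadic base. For odd p: a ≡
B^(p^r), where B^(p-1) ≢ 1 mod p², and m = 1. For p = 2: a ≡ 5^(2^(r-1)) and m = 2. The descent
length plus m is r + 1 in both cases. -/
theorem prime_dvd_of_exact {a : ℤ} (ha : ¬ (p : ℤ) ∣ a) {s r : ℕ} (hrs : r < s)
    (hr : (p : ℤ) ^ (r + 1) ∣ a ^ (p - 1) - 1) (hr' : ¬ (p : ℤ) ^ (r + 2) ∣ a ^ (p - 1) - 1)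
    {g : ℤ[X]} (hg : ∀ η : C, η ^ p ^ s = a → ‖aeval η g‖ ≤ (p : ℝ)⁻¹ ^ (r + 1))
    (hdeg : g.natDegree < p ^ s) : Polynomial.C (p : ℤ) ∣ g := by
  have h0 := inv_prime_pos p
  have h1 := inv_prime_lt_one p
  have hpp := Nat.prime_iff_prime_int.1 hp.out
  rcases Nat.eq_zero_or_pos r with rfl | hr0
  · exact prime_dvd_of_near (C := C) ha hr' hrs (X₀ := a) (by simp) (by simpa using hg) hdeg
  have hlt : ∀ t ≤ s, g.natDegree < p ^ s - p ^ t + p ^ t := fun t ht => by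
    rwa [Nat.sub_add_cancel (Nat.pow_le_pow_right hp.out.pos ht)]
  by_cases h2 : p = 2
  · subst h2
    obtain ⟨k, rfl⟩ : ∃ k, r = k + 1 := ⟨r - 1, by omega⟩
    obtain ⟨t, rfl⟩ : ∃ t, s = t + k := ⟨s - k, by omega⟩
    refine prime_dvd_of_descent (C := C) (t := t) (m := 2) (D := 2 ^ t) (Or.inr (by norm_num))
      (B := 5) (c := 1) (by norm_num) ?_ ?_ k a ?_ g (by simpa using hg) (hlt t (by omega))
    · have e : (((1 : ℤ) : C) ^ 2 ^ t - ((5 : ℤ) : C)) = -((2 : ℕ) : C) ^ 2 := by push_cast; norm_num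
      rw [e, norm_neg, norm_pow, norm_prime]
      norm_num
    · intro X₀ hX q hq hd
      exact two_dvd_of_near (by omega) (by simpa using hX) (by simpa using hq) hd
    · have : (2 : ℤ) ^ (k + 3) ∣ a - 5 ^ 2 ^ k := by
        obtain ⟨u, hu⟩ := exists_five_pow_eq k
        simp only [Nat.add_one_sub_one, pow_one, Nat.cast_ofNat] at hr hr'
        obtain ⟨w, hw⟩ := hr
        have hw2 : ¬ (2 : ℤ) ∣ w := fun ⟨w', hw'⟩ => hr' ⟨w', by rw [hw, hw']; ring⟩
        obtain ⟨w', rfl⟩ : ∃ w', w = 2 * w' + 1 := ⟨w / 2, by omega⟩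
        refine ⟨w' - u, ?_⟩
        rw [hu, eq_add_of_sub_eq hw]
        ring
      have := (norm_intCast_le_iff (p := 2) (C := C)).2 (by exact_mod_cast this)
      simpa using this
  · obtain ⟨t, rfl⟩ : ∃ t, s = t + r := ⟨s - r, by omega⟩
    obtain ⟨B, hBa⟩ := exists_pow_prime_pow_modEq h2 ha hr
    have hB : ¬ (p : ℤ) ∣ B := fun h => ha (by
      have h3 : (p : ℤ) ∣ B ^ p ^ r := dvd_pow h (pow_pos hp.out.pos r).ne'
      exact (dvd_sub_right h3).1 ((dvd_pow_self _ (by omega)).trans hBa))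
    have hB2 : ¬ (p : ℤ) ^ 2 ∣ B ^ (p - 1) - 1 := fun h => hr' (by
      have h3 := pow_dvd_pow_pow_sub_one (by norm_num) h r
      rw [← pow_mul, mul_comm, pow_mul, add_comm 2 r] at h3
      have h4 := hBa.trans (sub_dvd_pow_sub_pow _ _ (p - 1))
      have h5 := dvd_sub h3 h4
      rwa [sub_sub_sub_cancel_left] at h5)
    refine prime_dvd_of_descent (C := C) (t := t) (m := 1) (D := p ^ t) (Or.inr le_rfl) hB (c := B)
      ?_ ?_ r a ?_ g (by simpa using hg) (hlt t (by omega))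
    · have h3 : (p : ℤ) ^ 1 ∣ B ^ p ^ t - B :=
        pow_dvd_pow_prime_pow_sub (by simpa using dvd_pow_sub_one_sub_one hB) t
      have h4 := (norm_intCast_le_iff (C := C)).2 h3
      rw [pow_one] at h4
      push_cast at h4
      refine (pow_le_pow_left₀ (norm_nonneg _) h4 _).trans_lt ?_
      exact pow_lt_self_of_lt_one₀ h0 h1 (by have := hp.out.two_le; omega)
    · intro X₀ hX q hq hd
      exact prime_dvd_of_near hB hB2 (by omega) (by simpa using hX) (by simpa using hq) hd
    · have := (norm_intCast_le_iff (C := C)).2 hBa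
      rw [norm_sub_rev]
      simpa using this

theorem prime_dvd_of_norm_le {a : ℤ} (ha : ¬ (p : ℤ) ∣ a) {s k : ℕ} (hks : k ≤ s)
    (hr : (p : ℤ) ^ (k + 1) ∣ a ^ (p - 1) - 1) {g : ℤ[X]}
    (hk : k = s ∨ ¬ (p : ℤ) ^ (k + 2) ∣ a ^ (p - 1) - 1 ∨ g.natDegree < p ^ s - p ^ (s - (k + 1)))
    (hg : ∀ η : C, η ^ p ^ s = a → ‖aeval η g‖ ≤ (p : ℝ)⁻¹ ^ (k + 1))
    (hdeg : g.natDegree < p ^ s) : Polynomial.C (p : ℤ) ∣ g := by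
  by_cases hks' : k = s
  · subst hks'
    obtain ⟨y, hy⟩ := IsAlgClosed.exists_pow_nat_eq (a : C) (pow_pos hp.out.pos k)
    have hy1 : ‖y‖ = 1 := by
      have : ‖y‖ ^ p ^ k = 1 := by rw [← norm_pow, hy, norm_intCast_eq_one.2 ha]
      exact (pow_eq_one_iff_of_nonneg (norm_nonneg _) (pow_pos hp.out.pos k).ne').1 this
    rw [C_dvd_iff_dvd_coeff]
    intro i
    rcases lt_or_ge i (p ^ k) with hi | hi
    · have := norm_mul_sum_coeff_le (C := C) (N := p ^ k) (M := 1) hi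
        (h := g.map (Int.castRingHom C)) (by rw [mul_one]; exact natDegree_map_le.trans_lt hdeg)
        (x := a) (y := y) (by rwa [mul_one]) (R := (p : ℝ)⁻¹ ^ (k + 1))
        (by have := inv_prime_pos p; positivity)
        (fun z hz => by
          have := hg z (by rwa [mul_one] at hz)
          rwa [eval_map, ← algebraMap_int_eq, ← aeval_def])
      simp only [range_one, sum_singleton, mul_zero, add_zero, coeff_map, norm_mul, norm_pow, hy1,
        one_pow, mul_one, Nat.cast_pow, norm_prime] at this
      rw [pow_succ, mul_le_mul_iff_right₀ (pow_pos (inv_prime_pos p) k)] at this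
      have h2 := (norm_intCast_le_iff (p := p) (C := C) (z := g.coeff i) (m := 1)).1
        (by simpa using this)
      simpa using h2
    · rw [coeff_eq_zero_of_natDegree_lt (hdeg.trans_le hi)]
      exact dvd_zero _
  by_cases hd : (p : ℤ) ^ (k + 2) ∣ a ^ (p - 1) - 1
  · rcases hk with h | h | h
    · exact absurd h hks'
    · exact absurd hd h
    · exact prime_dvd_of_natDegree_lt ha (k := k + 1) (by omega) hd hg h
  · exact prime_dvd_of_exact ha (by omega) hr hd hg hdeg

theorem prime_pow_dvd_of_norm_le {a : ℤ} (ha : ¬ (p : ℤ) ∣ a) {s k : ℕ} (hks : k ≤ s)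
    (hr : (p : ℤ) ^ (k + 1) ∣ a ^ (p - 1) - 1) (e : ℕ) : ∀ {g : ℤ[X]},
    (k = s ∨ ¬ (p : ℤ) ^ (k + 2) ∣ a ^ (p - 1) - 1 ∨ g.natDegree < p ^ s - p ^ (s - (k + 1))) →
    (∀ η : C, η ^ p ^ s = a → ‖aeval η g‖ ≤ (p : ℝ)⁻¹ ^ (k + e)) → g.natDegree < p ^ s →
    Polynomial.C ((p : ℤ) ^ e) ∣ g := by
  have h0 := inv_prime_pos p
  have h1 := inv_prime_lt_one p
  have hp0 : (p : ℤ) ≠ 0 := by exact_mod_cast hp.out.ne_zero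
  induction e with
  | zero => intro g _ _ _; simp
  | succ e ih =>
    intro g hk hg hdeg
    obtain ⟨g', rfl⟩ := prime_dvd_of_norm_le ha hks hr hk (fun η hη => (hg η hη).trans
      (pow_le_pow_of_le_one h0.le h1.le (by omega))) hdeg
    rw [natDegree_C_mul hp0] at hk hdeg
    rw [pow_succ', C_mul]
    refine mul_dvd_mul_left _ (ih hk (fun η hη => ?_) hdeg)
    have := hg η hη
    rw [map_mul, aeval_C, norm_mul, ← add_assoc, pow_succ'] at this
    simp only [eq_intCast, Int.cast_natCast, norm_prime] at this
    rwa [mul_le_mul_iff_right₀ h0] at this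

/-- Clear denominators with an integer b of p-adic valuation e. If k ≤ e, the cleared polynomial is
divisible by p^(e-k), so p^k remains as a bound for the denominator; if e < k, integrality of its
coefficients is enough. -/
theorem norm_prime_pow_mul_coeff_le {a : ℤ} (ha : ¬ (p : ℤ) ∣ a) {s k : ℕ} (hks : k ≤ s)
    (hr : (p : ℤ) ^ (k + 1) ∣ a ^ (p - 1) - 1) {H : ℚ[X]}
    (hk : k = s ∨ ¬ (p : ℤ) ^ (k + 2) ∣ a ^ (p - 1) - 1 ∨ H.natDegree < p ^ s - p ^ (s - (k + 1)))
    (hH : ∀ η : C, η ^ p ^ s = a → ‖aeval η H‖ ≤ 1) (hdeg : H.natDegree < p ^ s) (i : ℕ) :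
    ‖(p : C) ^ k * (H.coeff i : C)‖ ≤ 1 := by
  have h0 := inv_prime_pos p
  have h1 := inv_prime_lt_one p
  obtain ⟨b, hbmem, hb⟩ := IsLocalization.integerNormalization_spec (nonZeroDivisors ℤ) H
  set g := IsLocalization.integerNormalization (nonZeroDivisors ℤ) H with hgdef
  have hb0 : b ≠ 0 := nonZeroDivisors.ne_zero hbmem
  have hgd : g.natDegree ≤ H.natDegree := by
    rw [← natDegree_map_eq_of_injective (algebraMap ℤ ℚ).injective_int g, hb]
    exact natDegree_smul_le _ _
  have hcoeff : ∀ i, (g.coeff i : ℚ) = b * H.coeff i := fun i => by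
    have := congrArg (fun f => f.coeff i) hb
    simp only [coeff_map, coeff_smul] at this
    rw [eq_intCast] at this
    rw [this, zsmul_eq_mul]
  obtain ⟨e, he⟩ := exists_norm_intCast_eq_pow (p := p) (C := C) hb0
  have hev : ∀ η : C, aeval η g = (b : C) * aeval η H := fun η => by
    rw [← aeval_map_algebraMap ℚ η g, hb, map_zsmul, zsmul_eq_mul]
  have hci : ((g.coeff i : ℤ) : C) = (b : C) * (H.coeff i : C) := by
    have := congrArg (fun q : ℚ => (q : C)) (hcoeff i)
    simpa using this
  have hpos : 0 < ‖(b : C)‖ := by rw [he]; positivity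
  rcases le_or_gt k e with hke | hke
  · have hdvd := prime_pow_dvd_of_norm_le (C := C) ha hks hr (e - k) (g := g)
      (hk.imp_right (Or.imp_right fun h => hgd.trans_lt h))
      (fun η hη => by
        rw [hev, norm_mul, he, Nat.add_sub_cancel' hke]
        exact mul_le_of_le_one_right (by positivity) (hH η hη)) (hgd.trans_lt hdeg)
    have h3 := (norm_intCast_le_iff (C := C)).2 ((C_dvd_iff_dvd_coeff _ _).1 hdvd i)
    rw [hci, norm_mul, he] at h3
    rw [norm_mul, norm_pow, norm_prime, ← mul_le_mul_iff_right₀ (pow_pos h0 (e - k)), ← mul_assoc,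
      ← pow_add, Nat.sub_add_cancel hke, mul_one]
    exact h3
  · have h3 := norm_intCast_le_one' p (C := C) (g.coeff i)
    rw [hci, norm_mul, he] at h3
    rw [norm_mul, norm_pow, norm_prime]
    refine le_trans ?_ h3
    gcongr ?_ * _
    exact pow_le_pow_of_le_one h0.le h1.le hke.le

end LocalBound

/-! ### Local bounds for the coefficients of h. -/

section Coefficients

variable {p : ℕ} [hp : Fact p.Prime] {C : Type*} [NormedField C] [NormedAlgebra ℚ_[p] C]
  [IsUltrametricDist C] [IsAlgClosed C] [CharZero C]

theorem exists_norm_ratCast_eq_zpow {q : ℚ} (hq : q ≠ 0) :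
    ∃ v : ℤ, ‖(q : C)‖ = (p : ℝ)⁻¹ ^ v := by
  refine ⟨(q : ℚ_[p]).valuation, ?_⟩
  rw [norm_ratCast_eq (p := p), Padic.norm_eq_zpow_neg_valuation (by exact_mod_cast hq), inv_zpow,
    zpow_neg]

theorem norm_sum_coeff_le_one {n' M i : ℕ} (hn' : ¬ p ∣ n') (hi : i < n') {h : ℚ[X]}
    (hdeg : h.natDegree < n' * M) {a : ℤ}
    (hh : ∀ z : C, z ^ (n' * M) = a → ‖aeval z h‖ ≤ 1) {y : C} (hy : y ^ (n' * M) = a) :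
    ‖∑ l ∈ range M, (h.coeff (i + n' * l) : C) * y ^ (i + n' * l)‖ ≤ 1 := by
  have := norm_mul_sum_coeff_le hi (h := h.map (algebraMap ℚ C))
    (natDegree_map_le.trans_lt hdeg) hy zero_le_one
    (fun z hz => by rw [eval_map, ← aeval_def]; exact hh z hz)
  have hn1 : ‖(n' : C)‖ = 1 := by
    exact_mod_cast norm_intCast_eq_one (p := p) (C := C) (z := n').2 (by exact_mod_cast hn')
  rw [norm_mul, hn1, one_mul] at this
  simpa using this

/-- The tame and the totally ramified case. -/
theorem norm_coeff_pow_mul_le_one {n' s j : ℕ} (hn' : ¬ p ∣ n') {a : ℤ}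
    (haj : ‖(a : C)‖ = (p : ℝ)⁻¹ ^ j) (hj : Nat.Coprime (p ^ s) j) {h : ℚ[X]}
    (hdeg : h.natDegree < n' * p ^ s) (hh : ∀ z : C, z ^ (n' * p ^ s) = a → ‖aeval z h‖ ≤ 1)
    (m : ℕ) : ‖(h.coeff m : C)‖ ^ (n' * p ^ s) * ‖(a : C)‖ ^ m ≤ 1 := by
  have h0 := inv_prime_pos p
  have h1 := inv_prime_lt_one p
  have hn'0 : 0 < n' := Nat.pos_of_ne_zero fun h => hn' (h ▸ dvd_zero p)
  have hps : 0 < p ^ s := pow_pos hp.out.pos s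
  have hn0 : 0 < n' * p ^ s := Nat.mul_pos hn'0 hps
  rcases le_or_gt (n' * p ^ s) m with hm | hm
  · rw [coeff_eq_zero_of_natDegree_lt (hdeg.trans_le hm)]
    simp [hn'0.ne', hp.out.ne_zero]
  obtain ⟨y, hy⟩ := IsAlgClosed.exists_pow_nat_eq (a : C) hn0
  have hterm : ∀ t, ‖(h.coeff t : C) * y ^ t‖ ^ (n' * p ^ s) =
      ‖(h.coeff t : C)‖ ^ (n' * p ^ s) * ‖(a : C)‖ ^ t := fun t => by
    rw [norm_mul, mul_pow, ← hy, norm_pow, norm_pow, ← pow_mul, ← pow_mul, mul_comm t]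
  have key := norm_le_of_norm_sum_le ?_ zero_le_one
    (norm_sum_coeff_le_one (p := p) hn' (Nat.mod_lt m hn'0) hdeg hh hy) (m / n')
    (mem_range.2 (Nat.div_lt_of_lt_mul hm))
  · rw [Nat.mod_add_div] at key
    rw [← hterm]
    exact pow_le_one₀ (norm_nonneg _) key
  · intro l hl l' hl' hne hne' heq
    have hc : h.coeff (m % n' + n' * l) ≠ 0 := fun h => hne (by rw [h]; simp)
    have hc' : h.coeff (m % n' + n' * l') ≠ 0 := fun h => hne' (by rw [h]; simp)
    obtain ⟨v, hv⟩ := exists_norm_ratCast_eq_zpow (p := p) (C := C) hc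
    obtain ⟨v', hv'⟩ := exists_norm_ratCast_eq_zpow (p := p) (C := C) hc'
    have h2 := congrArg (· ^ (n' * p ^ s)) heq
    simp only [hterm, hv, hv', haj] at h2
    rw [← zpow_natCast, ← zpow_natCast, ← zpow_natCast, ← zpow_natCast, ← zpow_natCast, ← zpow_mul,
      ← zpow_mul, ← zpow_mul, ← zpow_mul, ← zpow_add₀ h0.ne', ← zpow_add₀ h0.ne'] at h2
    have h3 := zpow_right_injective₀ h0 h1.ne h2
    push_cast at h3
    -- Equal norms equate n v + j(i + n' l) for two indices l; after division by n' this is a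
    -- congruence mod p^s, and j is prime to p^s.
    have h4 : ((p ^ s : ℕ) : ℤ) ∣ (l - l' : ℤ) * j := by
      refine ⟨v' - v, ?_⟩
      have : (n' : ℤ) * ((l - l' : ℤ) * j) = n' * (p ^ s * (v' - v)) := by linarith
      push_cast
      exact mul_left_cancel₀ (by exact_mod_cast hn'0.ne') this
    have h5 := (Nat.isCoprime_iff_coprime.2 hj).dvd_of_dvd_mul_right h4
    have hl2 := mem_range.1 hl
    have hl2' := mem_range.1 hl'
    have h6 := Int.eq_zero_of_abs_lt_dvd h5 (by rw [abs_lt]; omega)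
    omega

/-- The case of a prime dividing the degree but not the radicand. -/
theorem norm_prime_pow_mul_leadingCoeff_le {n' s k : ℕ} (hn' : ¬ p ∣ n') {a : ℤ}
    (ha : ¬ (p : ℤ) ∣ a) (hks : k ≤ s) (hr : (p : ℤ) ^ (k + 1) ∣ a ^ (p - 1) - 1) {h : ℚ[X]}
    (hk : k = s ∨ ¬ (p : ℤ) ^ (k + 2) ∣ a ^ (p - 1) - 1 ∨
      h.natDegree < n' * p ^ s - n' * p ^ (s - (k + 1)))
    (hdeg : h.natDegree < n' * p ^ s) (hh : ∀ z : C, z ^ (n' * p ^ s) = a → ‖aeval z h‖ ≤ 1) :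
    ‖(p : C) ^ k * (h.leadingCoeff : C)‖ ≤ 1 := by
  have hn'0 : 0 < n' := Nat.pos_of_ne_zero fun h => hn' (h ▸ dvd_zero p)
  have hps : 0 < p ^ s := pow_pos hp.out.pos s
  set t := h.natDegree with ht
  -- H keeps the exponents of h congruent to its degree t mod n', read as a polynomial in η = y^n';
  -- its top coefficient is that of h.
  set H : ℚ[X] := ∑ l ∈ range (t / n' + 1), Polynomial.C (h.coeff (t % n' + n' * l)) * X ^ l with hH
  have hHd : H.natDegree ≤ t / n' := by
    refine natDegree_sum_le_of_forall_le _ _ fun l hl => ?_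
    refine (natDegree_C_mul_X_pow_le _ _).trans ?_
    have := mem_range.1 hl
    omega
  have htn : t / n' < p ^ s := Nat.div_lt_of_lt_mul hdeg
  have hHc : H.coeff (t / n') = h.leadingCoeff := by
    rw [hH, finsetSum_coeff, sum_eq_single (t / n')]
    · rw [coeff_C_mul_X_pow, if_pos rfl, Nat.mod_add_div, ht, leadingCoeff]
    · intro l _ hl
      rw [coeff_C_mul_X_pow, if_neg (Ne.symm hl)]
    · intro h; exact absurd (mem_range.2 (Nat.lt_succ_self _)) h
  rw [← hHc]
  refine norm_prime_pow_mul_coeff_le ha hks hr ?_ (fun η hη => ?_) (hHd.trans_lt htn) _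
  · refine hk.imp_right (Or.imp_right fun h => hHd.trans_lt (Nat.div_lt_of_lt_mul ?_))
    rwa [Nat.mul_sub]
  · obtain ⟨y, hy⟩ := IsAlgClosed.exists_pow_nat_eq η hn'0
    have hya : y ^ (n' * p ^ s) = a := by rw [pow_mul, hy, hη]
    have hy1 : ‖y‖ = 1 := by
      have : ‖y‖ ^ (n' * p ^ s) = 1 := by rw [← norm_pow, hya, norm_intCast_eq_one.2 ha]
      exact (pow_eq_one_iff_of_nonneg (norm_nonneg _) (Nat.mul_pos hn'0 hps).ne').1 this
    have key := norm_sum_coeff_le_one (p := p) hn' (Nat.mod_lt t hn'0) hdeg hh hya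
    have hsplit : ∑ l ∈ range (p ^ s), (h.coeff (t % n' + n' * l) : C) * y ^ (t % n' + n' * l) =
        y ^ (t % n') * aeval η H := by
      rw [hH, map_sum, mul_sum]
      symm
      refine (sum_subset_zero_on_sdiff (range_subset_range.2 htn) ?_ ?_)
      · intro l hl
        have : t / n' < l := by simpa using (mem_sdiff.1 hl).2
        rw [coeff_eq_zero_of_natDegree_lt]
        · simp
        · rw [← ht, ← Nat.mod_add_div t n']
          have : n' * (t / n') < n' * l := Nat.mul_lt_mul_of_pos_left this hn'0
          simp only [Nat.add_mul_mod_self_left, Nat.mod_mod]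
          omega
      · intro l _
        rw [map_mul, aeval_C, map_pow, aeval_X, ← hy, pow_add, pow_mul, eq_ratCast]
        ring
    rw [hsplit, norm_mul, norm_pow, hy1, one_pow, one_mul] at key
    exact key

end Coefficients

/-! ### Integrality in K tested at all n-th roots of a. -/

section Integrality

variable {K : Type*} [Field K] [NumberField K]

theorem exists_intCast_eq_of_norm_le_one {q : ℚ}
    (h : ∀ (p : ℕ) [Fact p.Prime], ‖(q : ℚ_[p])‖ ≤ 1) : ∃ z : ℤ, (z : ℚ) = q := by
  have hden : q.den = 1 := by
    by_contra hne
    obtain ⟨p, hp, hpd⟩ := Nat.exists_prime_and_dvd hne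
    have : Fact p.Prime := ⟨hp⟩
    have hnum : ‖(q.num : ℚ_[p])‖ = 1 := by
      rw [Padic.norm_intCast_eq_one_iff, Int.isCoprime_iff_gcd_eq_one]
      exact Nat.Coprime.coprime_dvd_right (by simpa using hpd) q.reduced
    have hd : ‖(q.den : ℚ_[p])‖ < 1 := Padic.norm_natCast_lt_one_iff.2 hpd
    have hmul : (q : ℚ_[p]) * (q.den : ℚ_[p]) = q.num := by
      exact_mod_cast congrArg (fun r : ℚ => (r : ℚ_[p])) (Rat.mul_den_eq_num q)
    have h1 := congrArg norm hmul
    rw [norm_mul, hnum] at h1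
    have h2 := mul_le_of_le_one_left (norm_nonneg (q.den : ℚ_[p])) (h p)
    rw [h1] at h2
    exact absurd hd (not_lt.2 h2)
  exact ⟨q.num, Rat.coe_int_num_of_den_eq_one hden⟩

theorem isIntegral_of_norm_coeff_minpoly_le {x : K}
    (h : ∀ (p : ℕ) [Fact p.Prime] (i : ℕ), ‖((minpoly ℚ x).coeff i : ℚ_[p])‖ ≤ 1) :
    IsIntegral ℤ x := by
  have hint : ∀ i, ∃ z : ℤ, (z : ℚ) = (minpoly ℚ x).coeff i := fun i =>
    exists_intCast_eq_of_norm_le_one fun p _ => h p i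
  have hlift : minpoly ℚ x ∈ Polynomial.lifts (algebraMap ℤ ℚ) := by
    rw [Polynomial.lifts_iff_coeff_lifts]
    intro i
    obtain ⟨z, hz⟩ := hint i
    exact ⟨z, by simpa using hz⟩
  obtain ⟨P, hP, -, hPm⟩ := Polynomial.lifts_and_natDegree_eq_and_monic hlift
    (minpoly.monic (Algebra.IsIntegral.isIntegral x))
  refine ⟨P, hPm, ?_⟩
  rw [← aeval_def, ← aeval_map_algebraMap ℚ, hP, minpoly.aeval]

variable {p : ℕ} [hp : Fact p.Prime] {C : Type*} [NormedField C] [NormedAlgebra ℚ_[p] C]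
  [IsUltrametricDist C]

theorem norm_coeff_prod_X_sub_C_le (s : Multiset C) (hs : ∀ r ∈ s, ‖r‖ ≤ 1) (i : ℕ) :
    ‖((s.map fun r => X - Polynomial.C r).prod).coeff i‖ ≤ 1 := by
  induction s using Multiset.induction generalizing i with
  | empty =>
    simp only [Multiset.map_zero, Multiset.prod_zero, coeff_one]
    split_ifs <;> simp
  | cons r s ih =>
    have ih' := ih fun r hr => hs r (Multiset.mem_cons_of_mem hr)
    have hr := hs r (Multiset.mem_cons_self r s)
    rw [Multiset.map_cons, Multiset.prod_cons, sub_mul, coeff_sub, coeff_C_mul]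
    refine norm_sub_le_of_le ?_ ?_
    · cases i with
      | zero => simp
      | succ i => rw [coeff_X_mul]; exact ih' i
    · rw [norm_mul]; exact mul_le_one₀ hr (norm_nonneg _) (ih' i)

variable [IsAlgClosed C] [CharZero C]

-- The roots of the minimal polynomial of h(θ) in C are h(ψ(θ)) for embeddings ψ, and ψ(θ)^n = a.
variable (C) in
theorem norm_coeff_minpoly_aeval_le {θ : K} {n : ℕ} {a : ℤ} (hθ : θ ^ n = a) {h : ℚ[X]}
    (hh : ∀ y : C, y ^ n = a → ‖aeval y h‖ ≤ 1) (i : ℕ) :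
    ‖((minpoly ℚ (aeval θ h)).coeff i : ℚ_[p])‖ ≤ 1 := by
  rw [← norm_ratCast_eq (C := C)]
  set x := aeval θ h with hx
  have hmonic := (minpoly.monic (Algebra.IsIntegral.isIntegral (R := ℚ) x)).map (algebraMap ℚ C)
  have hprod := (IsAlgClosed.splits ((minpoly ℚ x).map (algebraMap ℚ C))).eq_prod_roots_of_monic
    hmonic
  have hc : ((minpoly ℚ x).coeff i : C) = ((minpoly ℚ x).map (algebraMap ℚ C)).coeff i := by
    rw [coeff_map, eq_ratCast]
  rw [hc, hprod]
  refine norm_coeff_prod_X_sub_C_le _ (fun r hr => ?_) i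
  have hr' : r ∈ (minpoly ℚ x).rootSet C := by
    rw [mem_rootSet']
    rw [mem_roots'] at hr
    refine ⟨hr.1, ?_⟩
    rw [aeval_def, ← eval_map]
    exact hr.2
  rw [← Algebra.IsAlgebraic.range_eval_eq_rootSet_minpoly C x] at hr'
  obtain ⟨ψ, rfl⟩ := hr'
  simp only [hx]
  rw [← aeval_algHom_apply]
  refine hh _ ?_
  rw [← map_pow, hθ, map_intCast]

/-- Every y with y^n = a is a conjugate of θ, so h(y) satisfies the same monic integer equation as
h(θ). -/
theorem norm_aeval_le_of_isIntegral (p : ℕ) [Fact p.Prime] {C : Type*} [NormedField C]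
    [NormedAlgebra ℚ_[p] C] [IsUltrametricDist C] [CharZero C] {θ : K} {n : ℕ} {a : ℤ}
    (hθ : minpoly ℚ θ = X ^ n - Polynomial.C (a : ℚ)) {h : ℚ[X]} (hint : IsIntegral ℤ (aeval θ h))
    {y : C} (hy : y ^ n = a) : ‖aeval y h‖ ≤ 1 := by
  obtain ⟨P, hP, hPe⟩ := hint
  have h1 : aeval θ ((P.map (algebraMap ℤ ℚ)).comp h) = 0 := by
    rw [aeval_comp, aeval_map_algebraMap, aeval_def, hPe]
  obtain ⟨Q, hQ⟩ := minpoly.dvd ℚ θ h1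
  have h2 : aeval y ((P.map (algebraMap ℤ ℚ)).comp h) = 0 := by
    rw [hQ, map_mul, hθ]
    simp [hy]
  rw [aeval_comp, aeval_map_algebraMap] at h2
  set z := aeval y h
  by_contra! hcon
  have hlead : P = X ^ P.natDegree + P.eraseLead := by
    conv_lhs => rw [← P.eraseLead_add_C_mul_X_pow, hP.leadingCoeff]
    simp [add_comm]
  rcases Nat.eq_zero_or_pos P.natDegree with hd | hd
  · rw [hP.natDegree_eq_zero.1 hd, map_one] at h2
    exact one_ne_zero h2
  have hlow : ‖aeval z P.eraseLead‖ ≤ ‖z‖ ^ (P.natDegree - 1) := by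
    rw [aeval_eq_sum_range' (n := P.natDegree)
      (lt_of_le_of_lt P.eraseLead_natDegree_le (Nat.sub_lt hd one_pos))]
    refine IsUltrametricDist.norm_sum_le_of_forall_le_of_nonneg (by positivity) fun i hi => ?_
    rw [zsmul_eq_mul, norm_mul, norm_pow]
    refine (mul_le_of_le_one_left (by positivity) (norm_intCast_le_one' p _)).trans ?_
    exact pow_le_pow_right₀ hcon.le (Nat.le_sub_one_of_lt (mem_range.1 hi))
  rw [hlead, map_add, map_pow, aeval_X, ← eq_neg_iff_add_eq_zero] at h2
  rw [← norm_neg, ← h2, norm_pow] at hlow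
  exact absurd hlow (not_le.2 (pow_lt_pow_right₀ hcon (Nat.sub_lt hd one_pos)))

end Integrality

/-! ### The geometric sum behind δ. -/

section GeometricSum

variable {p : ℕ} [hp : Fact p.Prime] {C : Type*} [NormedField C] [NormedAlgebra ℚ_[p] C]
  [IsUltrametricDist C]

/-- If ‖T - 1‖ > 1/p, divide T^(p^k) - 1 by T - 1. Otherwise the sum is a product of k factors
`geomSum₂`, each of norm at most 1/p. -/
theorem norm_geom_sum_le {T : C} {k : ℕ} (hT : ‖T‖ ≤ 1)
    (h : ‖T ^ p ^ k - 1‖ ≤ (p : ℝ)⁻¹ ^ (k + 1)) :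
    ‖∑ r ∈ range (p ^ k), T ^ r‖ ≤ (p : ℝ)⁻¹ ^ k := by
  have h0 := inv_prime_pos p
  have h1 := inv_prime_lt_one p
  rcases eq_or_ne T 1 with rfl | hT1
  · simp [norm_prime p C]
  have hpos : 0 < ‖T - 1‖ := norm_pos_iff.2 (sub_ne_zero.2 hT1)
  have hmul : ‖∑ r ∈ range (p ^ k), T ^ r‖ * ‖T - 1‖ = ‖T ^ p ^ k - 1‖ := by
    rw [← norm_mul, geom_sum_mul]
  rw [← mul_le_mul_iff_of_pos_right hpos, hmul]
  rcases le_or_gt ‖T - 1‖ (p : ℝ)⁻¹ with hle | hgt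
  · clear h hmul
    induction k with
    | zero => simp
    | succ k ih =>
      have hTk : ‖T ^ p ^ k‖ ≤ 1 := by rw [norm_pow]; exact pow_le_one₀ (norm_nonneg _) hT
      have h2 := geomSum₂_mul p (T ^ p ^ k) 1
      rw [one_pow, ← pow_mul, ← pow_succ] at h2
      rw [← h2, norm_mul, pow_succ', mul_assoc]
      refine mul_le_mul (norm_geomSum₂_le hTk norm_one.le ?_) ih (norm_nonneg _) h0.le
      have h3 : ‖T ^ p ^ k - 1‖ ≤ (p : ℝ)⁻¹ := by
        have := norm_pow_sub_pow_le hT (norm_one (α := C)).le (p ^ k)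
        rw [one_pow] at this
        exact this.trans hle
      refine (pow_le_of_le_one (norm_nonneg _) (h3.trans h1.le) ?_).trans h3
      have := hp.out.two_le
      omega
  · refine h.trans ?_
    rw [pow_succ]
    gcongr

end GeometricSum

/-! ### The indices k, j and the set S_m. -/

section Indices

variable {n : ℕ} {a : ℤ} {p m : ℕ}

theorem expK_le_expD : expK n a p m ≤ expD n a p := Nat.findGreatest_le _

theorem sub_div_pow_expK_le : n - n / p ^ expK n a p m ≤ m :=
  Nat.findGreatest_spec (P := fun k => n - n / p ^ k ≤ m) (Nat.zero_le _) (by simp)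

theorem lt_sub_div_pow_of_expK_lt {k : ℕ} (h : expK n a p m < k) (hk : k ≤ expD n a p) :
    m < n - n / p ^ k :=
  not_le.1 (Nat.findGreatest_is_greatest (P := fun k => n - n / p ^ k ≤ m) h hk)

theorem setSm_subset : setSm n a m ⊆ setS n a := filter_subset _ _

theorem prime_of_mem_setS (h : p ∈ setS n a) : p.Prime :=
  Nat.prime_of_mem_primeFactors (mem_filter.1 h).1

theorem two_le_padicValInt_of_mem_setS (h : p ∈ setS n a) :
    2 ≤ padicValInt p (a ^ (p - 1) - 1) := by
  have := (mem_filter.1 h).2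
  unfold expR at this
  omega

theorem expK_le_factorization : expK n a p m ≤ n.factorization p :=
  expK_le_expD.trans (min_le_right _ _)

theorem pow_expK_dvd : p ^ expK n a p m ∣ n :=
  (pow_dvd_pow p expK_le_factorization).trans (Nat.ordProj_dvd n p)

theorem pow_expK_succ_dvd [Fact p.Prime] (h : p ∈ setS n a) :
    (p : ℤ) ^ (expK n a p m + 1) ∣ a ^ (p - 1) - 1 := by
  rw [padicValInt_dvd_iff]
  right
  have h1 : expK n a p m ≤ (expR a p).toNat := expK_le_expD.trans (min_le_left _ _)
  have h2 := two_le_padicValInt_of_mem_setS h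
  unfold expR at h1
  omega

theorem not_dvd_of_mem_setS [hp : Fact p.Prime] (h : p ∈ setS n a) : ¬ (p : ℤ) ∣ a := by
  intro ha
  have h1 : (p : ℤ) ∣ a ^ (p - 1) - 1 :=
    (dvd_pow_self _ (Nat.succ_ne_zero _)).trans (pow_expK_succ_dvd (m := 0) h)
  have h2 : (p : ℤ) ∣ a ^ (p - 1) := dvd_pow ha (by have := hp.out.two_le; omega)
  exact (Nat.prime_iff_prime_int.1 hp.out).not_dvd_one ((dvd_sub_right h2).1 h1)

/-- θ^m is thus, up to a constant, the term r = p^k - 1 that the sum in `delta` omits. -/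
theorem expJ_add :
    expJ n a p m + n / p ^ expK n a p m * (p ^ expK n a p m - 1) = m := by
  have h1 := sub_div_pow_expK_le (n := n) (a := a) (p := p) (m := m)
  have h2 := Nat.div_mul_cancel (pow_expK_dvd (n := n) (a := a) (p := p) (m := m))
  unfold expJ
  rw [Nat.mul_sub, mul_one, h2]
  omega

end Indices

/-! ### The basis elements as polynomials in θ. -/

section Polynomials

variable (n : ℕ) (a : ℤ) (c : ℕ → ℕ) (b w u : ℕ → ℕ → ℤ)

/-- The polynomial whose value at `θ` is `delta`. -/
noncomputable def deltaPoly (p m : ℕ) : ℤ[X] :=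
  C (w p m) * C (coeffC n c m : ℤ) * X ^ expJ n a p m *
    ∑ r ∈ range (p ^ expK n a p m - 1), (C (aPrime n a b p m) * X ^ (n / p ^ expK n a p m)) ^ r

/-- The polynomial whose value at `θ` is `beta`. -/
noncomputable def betaPoly (m : ℕ) : ℤ[X] :=
  ∑ p ∈ setSm n a m, C (u p m) * C (coeffZ n a p m : ℤ) * deltaPoly n a c b w p m

/-- The common denominator of `θ ^ m + β_m`. -/
def denom (m : ℕ) : ℕ := coeffC n c m * ∏ p ∈ setS n a, p ^ expK n a p m

/-- The polynomial whose value at `θ` is the `m`-th element of the integral basis. -/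
noncomputable def basisPoly (m : ℕ) : ℚ[X] :=
  C ((denom n a c m : ℚ)⁻¹) * (X ^ m + (betaPoly n a c b w u m).map (algebraMap ℤ ℚ))

variable {n a c b w u}

theorem aeval_deltaPoly {K : Type*} [Field K] (θ : K) (p m : ℕ) :
    aeval θ (deltaPoly n a c b w p m) = delta n a c b w θ p m := by
  simp [deltaPoly, delta, map_sum]

theorem aeval_betaPoly {K : Type*} [Field K] (θ : K) (m : ℕ) :
    aeval θ (betaPoly n a c b w u m) = beta n a c b w u θ m := by
  simp [betaPoly, beta, map_sum, aeval_deltaPoly]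

theorem aeval_basisPoly {K : Type*} [Field K] [CharZero K] (θ : K) (m : ℕ) :
    aeval θ (basisPoly n a c b w u m) =
      (θ ^ m + beta n a c b w u θ m) / (denom n a c m : K) := by
  rw [basisPoly, map_mul, map_add, aeval_map_algebraMap, aeval_betaPoly, aeval_C, map_pow, aeval_X,
    map_inv₀, map_natCast, div_eq_inv_mul]

theorem degree_betaPoly_lt (hn : 1 ≤ n) (m : ℕ) : (betaPoly n a c b w u m).degree < m := by
  rw [← mem_degreeLT]
  refine Submodule.sum_mem _ fun p hp => ?_
  have hpS := setSm_subset hp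
  have hk := (mem_filter.1 hp).2
  have hpp := prime_of_mem_setS hpS
  have h2 : 2 ≤ p ^ expK n a p m := hpp.two_le.trans (Nat.le_self_pow (by omega) p)
  have hdiv : 0 < n / p ^ expK n a p m :=
    Nat.div_pos (Nat.le_of_dvd hn pow_expK_dvd) (pow_pos hpp.pos _)
  have hJ := expJ_add (n := n) (a := a) (p := p) (m := m)
  rw [← C_mul, ← smul_eq_C_mul]
  refine Submodule.smul_mem _ _ ?_
  rw [deltaPoly, mul_sum]
  refine Submodule.sum_mem _ fun r hr => ?_
  have hr' : r + 1 ≤ p ^ expK n a p m - 1 := mem_range.1 hr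
  rw [mem_degreeLT, mul_pow, ← C_pow, ← pow_mul, ← C_mul, mul_assoc, mul_left_comm (X ^ _),
    ← mul_assoc, ← C_mul, ← pow_add]
  refine (degree_C_mul_X_pow_le _ _).trans_lt ?_
  have := Nat.mul_le_mul_left (n / p ^ expK n a p m) hr'
  rw [mul_add, mul_one] at this
  exact_mod_cast (by omega : expJ n a p m + n / p ^ expK n a p m * r < m)

end Polynomials

/-! ### Valuations of a, C_m and the denominators. -/

section Valuation

variable {p : ℕ} [hp : Fact p.Prime] {C : Type*} [NormedField C] [NormedAlgebra ℚ_[p] C]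

theorem norm_natCast_eq_one_of_not_dvd {x : ℕ} (h : ¬ p ∣ x) : ‖(x : C)‖ = 1 := by
  exact_mod_cast norm_intCast_eq_one (p := p) (C := C) (z := x).2 (by exact_mod_cast h)

/-- p divides at most one c_j, and that one exactly once; j = 0 encodes that it divides none. -/
theorem exists_norm_prod_pow {n : ℕ} (hn : 1 ≤ n) {a : ℤ} {c : ℕ → ℕ} (hc : IsDecomposition n a c) :
    ∃ j < n, ∀ e : ℕ → ℕ, e 0 = 0 →
      ‖((∏ i ∈ Icc 1 (n - 1), c i ^ e i : ℕ) : C)‖ = (p : ℝ)⁻¹ ^ e j := by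
  by_cases h : ∃ j ∈ Icc 1 (n - 1), p ∣ c j
  · obtain ⟨j, hj, hpj⟩ := h
    refine ⟨j, by have := mem_Icc.1 hj; omega, fun e _ => ?_⟩
    have hother : ∀ i ∈ Icc 1 (n - 1), i ≠ j → ‖((c i : ℕ) : C)‖ ^ e i = 1 := fun i hi hij => by
      rw [norm_natCast_eq_one_of_not_dvd (p := p), one_pow]
      intro hpi
      exact hp.out.one_lt.ne' (Nat.dvd_one.1 ((hc.coprime i hi j hj hij) ▸ Nat.dvd_gcd hpi hpj))
    have hcj : ‖((c j : ℕ) : C)‖ = (p : ℝ)⁻¹ := by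
      have := norm_intCast_eq_pow (p := p) (C := C) (z := c j) (m := 1)
        (by simpa using Int.natCast_dvd_natCast.2 hpj) (fun h2 => by
          have h3 : p * p ∣ c j := by
            have : ((p * p : ℕ) : ℤ) ∣ (c j : ℤ) := by push_cast; simpa [pow_two] using h2
            exact_mod_cast this
          exact hp.out.one_lt.ne' (Nat.isUnit_iff.1 (hc.squarefree j hj p h3)))
      simpa using this
    rw [Nat.cast_prod, norm_prod, prod_eq_single j]
    · rw [Nat.cast_pow, norm_pow, hcj]
    · intro i hi hij
      rw [Nat.cast_pow, norm_pow]
      exact hother i hi hij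
    · exact fun h => absurd hj h
  · push Not at h
    refine ⟨0, hn, fun e he => ?_⟩
    rw [he, pow_zero, Nat.cast_prod, norm_prod]
    refine prod_eq_one fun i hi => ?_
    rw [Nat.cast_pow, norm_pow, norm_natCast_eq_one_of_not_dvd (p := p) (h i hi), one_pow]

theorem exists_norm_coeffC {n : ℕ} (hn : 1 ≤ n) {a : ℤ} {c : ℕ → ℕ} (hc : IsDecomposition n a c) :
    ∃ j < n, ‖(a : C)‖ = (p : ℝ)⁻¹ ^ j ∧
      ∀ m, ‖(coeffC n c m : C)‖ = (p : ℝ)⁻¹ ^ (j * m / n) := by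
  obtain ⟨j, hjn, hj⟩ := exists_norm_prod_pow (p := p) (C := C) hn hc
  refine ⟨j, hjn, ?_, fun m => hj (fun i => i * m / n) (by simp)⟩
  rw [← hj (fun i => i) rfl, hc.prod_eq]
  rcases Int.natAbs_eq a with h | h
  · conv_lhs => rw [h, Int.cast_natCast]
  · conv_lhs => rw [h, Int.cast_neg, Int.cast_natCast, norm_neg]

theorem norm_prod_pow_expK {n : ℕ} {a : ℤ} (m : ℕ) :
    ‖((∏ q ∈ setS n a, q ^ expK n a q m : ℕ) : C)‖ =
      if p ∈ setSm n a m then (p : ℝ)⁻¹ ^ expK n a p m else 1 := by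
  have hone : ∀ q ∈ setS n a, q ≠ p → ‖((q ^ expK n a q m : ℕ) : C)‖ = 1 := fun q hq hqp => by
    rw [Nat.cast_pow, norm_pow, norm_natCast_eq_one_of_not_dvd (p := p), one_pow]
    exact fun h => hqp ((Nat.prime_dvd_prime_iff_eq hp.out (prime_of_mem_setS hq)).1 h).symm
  rw [Nat.cast_prod, norm_prod]
  split_ifs with h
  · rw [prod_eq_single p hone (fun h' => absurd (setSm_subset h) h'), Nat.cast_pow, norm_pow,
      norm_prime]
  · refine prod_eq_one fun q hq => ?_
    by_cases hqp : q = p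
    · subst hqp
      have : expK n a q m = 0 := by
        by_contra hne
        exact h (mem_filter.2 ⟨hq, Nat.one_le_iff_ne_zero.2 hne⟩)
      simp [this]
    · exact hone q hq hqp

theorem norm_denom {n : ℕ} {a : ℤ} {c : ℕ → ℕ} (m : ℕ) :
    ‖(denom n a c m : C)‖ = ‖(coeffC n c m : C)‖ *
      if p ∈ setSm n a m then (p : ℝ)⁻¹ ^ expK n a p m else 1 := by
  rw [denom, Nat.cast_mul, norm_mul, norm_prod_pow_expK (p := p)]

end Valuation

/-! ### Integrality of the basis elements. -/

section BasisIntegral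

variable {p : ℕ} [hp : Fact p.Prime] {C : Type*} [NormedField C] [NormedAlgebra ℚ_[p] C]
  [IsUltrametricDist C] {n : ℕ} {a : ℤ} {c : ℕ → ℕ} {b w u : ℕ → ℕ → ℤ}

/-- In both cases of the definition a'^(p^k) is b'^(p^e) for some e, and a^(p^e) ≡ a mod p^(k+1). -/
theorem pow_dvd_aPrime_pow_mul_sub_one (hadm : IsAdmissible n a c b w u) {m : ℕ} (hm : m < n)
    (hpm : p ∈ setSm n a m) :
    (p : ℤ) ^ (expK n a p m + 1) ∣ aPrime n a b p m ^ p ^ expK n a p m * a - 1 := by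
  set k := expK n a p m with hk
  have hdvd : ∀ e, (p : ℤ) ^ (k + 1) ∣ b p m ^ p ^ e * a - 1 := fun e => by
    have h1 := pow_dvd_pow_prime_pow_sub (pow_expK_succ_dvd (m := m) (setSm_subset hpm)) e
    have h2 : (p : ℤ) ^ (k + 1) ∣ (a * b p m) ^ p ^ e - 1 :=
      (hadm.inv m hm p hpm).symm.dvd.trans (sub_one_dvd_pow_sub_one _ _)
    have h3 := dvd_sub h2 (dvd_mul_of_dvd_right h1 (b p m ^ p ^ e))
    have e' : b p m ^ p ^ e * a - 1 =
        (a * b p m) ^ p ^ e - 1 - b p m ^ p ^ e * (a ^ p ^ e - a) := by rw [mul_pow]; ring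
    rwa [e']
  unfold aPrime
  rw [← hk]
  split_ifs with h
  · rw [← pow_mul, ← pow_add]
    exact hdvd _
  · exact hdvd _

theorem norm_pow_add_delta_le (hadm : IsAdmissible n a c b w u) {m : ℕ} (hm : m < n)
    (hpm : p ∈ setSm n a m) {y : C} (hy : y ^ n = a) :
    ‖y ^ m + delta n a c b w y p m‖ ≤ (p : ℝ)⁻¹ ^ expK n a p m := by
  have hn : 1 ≤ n := by omega
  have hpS := setSm_subset hpm
  have hy1 : ‖y‖ ≤ 1 := norm_le_one_of_pow_eq (by omega) hy (norm_intCast_le_one' p a)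
  have hJ := expJ_add (n := n) (a := a) (p := p) (m := m)
  have hN := Nat.div_mul_cancel (pow_expK_dvd (n := n) (a := a) (p := p) (m := m))
  have hT := pow_dvd_aPrime_pow_mul_sub_one hadm hm hpm
  have hW := (hadm.weight m hm p hpm).dvd
  have hpk : 1 ≤ p ^ expK n a p m := Nat.one_le_pow _ _ hp.out.pos
  unfold delta
  set k := expK n a p m
  set J := expJ n a p m
  set a' := aPrime n a b p m
  set Y := y ^ (n / p ^ k) with hY
  have hYn : Y ^ p ^ k = a := by rw [hY, ← pow_mul, hN, hy]
  have hym : y ^ m = y ^ J * Y ^ (p ^ k - 1) := by rw [hY, ← pow_mul, ← pow_add, hJ]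
  have hY1 : ‖Y‖ ≤ 1 := by rw [hY, norm_pow]; exact pow_le_one₀ (norm_nonneg _) hy1
  have hTn : ‖(a' : C) * Y‖ ≤ 1 := by
    rw [norm_mul]; exact mul_le_one₀ (norm_intCast_le_one' p _) (norm_nonneg _) hY1
  have hgeom := norm_geom_sum_le (p := p) (T := (a' : C) * Y) (k := k) hTn (by
    rw [mul_pow, hYn]
    have := (norm_intCast_le_iff (C := C)).2 hT
    push_cast at this
    exact this)
  -- Modulo p^k, y^m equals w C_m y^J (a'Y)^(p^k-1), the term that completes the geometric sum.
  have hsplit : y ^ m + (w p m : C) * (coeffC n c m : C) * y ^ J *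
      ∑ r ∈ range (p ^ k - 1), ((a' : C) * Y) ^ r =
      y ^ m * ((1 - w p m * (coeffC n c m : ℤ) * a' ^ (p ^ k - 1) : ℤ) : C) +
        (w p m : C) * (coeffC n c m : C) * y ^ J * ∑ r ∈ range (p ^ k), ((a' : C) * Y) ^ r := by
    conv_rhs => rw [show p ^ k = (p ^ k - 1) + 1 by omega, sum_range_succ,
      show p ^ k - 1 + 1 - 1 = p ^ k - 1 by omega]
    rw [hym]
    push_cast
    ring
  rw [hsplit]
  refine norm_add_le_of_le ?_ ?_
  · rw [norm_mul, norm_pow]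
    exact (mul_le_of_le_one_left (norm_nonneg _) (pow_le_one₀ (norm_nonneg _) hy1)).trans
      (norm_intCast_le_iff.2 hW)
  · rw [norm_mul, norm_mul, norm_mul, norm_pow]
    refine (mul_le_of_le_one_left (norm_nonneg _) ?_).trans hgeom
    exact mul_le_one₀ (mul_le_one₀ (norm_intCast_le_one' p _) (norm_nonneg _)
      (IsUltrametricDist.norm_natCast_le_one _ _)) (by positivity) (pow_le_one₀ (norm_nonneg _) hy1)

theorem norm_delta_le {y : C} (hy : ‖y‖ ≤ 1) (q m : ℕ) :
    ‖delta n a c b w y q m‖ ≤ ‖(coeffC n c m : C)‖ := by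
  unfold delta
  rw [norm_mul, norm_mul, norm_mul, mul_comm ‖(w q m : C)‖, mul_assoc, mul_assoc]
  refine mul_le_of_le_one_right (norm_nonneg _) ?_
  refine mul_le_one₀ (IsUltrametricDist.norm_intCast_le_one _ _) (by positivity) (mul_le_one₀ ?_ (norm_nonneg _) ?_)
  · rw [norm_pow]; exact pow_le_one₀ (norm_nonneg _) hy
  · refine IsUltrametricDist.norm_sum_le_of_forall_le_of_nonneg zero_le_one fun r _ => ?_
    rw [norm_pow, norm_mul, norm_pow]
    exact pow_le_one₀ (by positivity) (mul_le_one₀ (IsUltrametricDist.norm_intCast_le_one _ _) (by positivity)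
      (pow_le_one₀ (norm_nonneg _) hy))

/-- Chinese remaindering: β ≡ δ_p mod p^k, since z_q is divisible by p^k for q ≠ p and the
coefficients sum to 1. -/
theorem norm_pow_add_beta_le (hadm : IsAdmissible n a c b w u) {m : ℕ} (hm : m < n)
    (hpm : p ∈ setSm n a m) {y : C} (hy : y ^ n = a) :
    ‖y ^ m + beta n a c b w u y m‖ ≤ (p : ℝ)⁻¹ ^ expK n a p m := by
  have hy1 : ‖y‖ ≤ 1 := norm_le_one_of_pow_eq (by omega) hy (norm_intCast_le_one' p a)
  have hδ : ∀ q, ‖delta n a c b w y q m‖ ≤ 1 := fun q =>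
    (norm_delta_le hy1 q m).trans (IsUltrametricDist.norm_natCast_le_one _ _)
  have hbez : ∑ q ∈ setSm n a m, (u q m : C) * (coeffZ n a q m : C) = 1 := by
    have := congrArg (fun z : ℤ => (z : C)) (hadm.bezout m hm ⟨p, hpm⟩)
    simpa using this
  have hsplit : y ^ m + beta n a c b w u y m = (y ^ m + delta n a c b w y p m) +
      ∑ q ∈ (setSm n a m).erase p, (u q m : C) * (coeffZ n a q m : C) *
        (delta n a c b w y q m - delta n a c b w y p m) := by
    have h1 := add_sum_erase (setSm n a m) (fun q => (u q m : C) * (coeffZ n a q m : C) *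
        (delta n a c b w y q m - delta n a c b w y p m)) hpm
    rw [sub_self, mul_zero, zero_add] at h1
    rw [h1]
    simp only [mul_sub, sum_sub_distrib]
    rw [← sum_mul, hbez, one_mul, beta]
    ring
  rw [hsplit]
  refine norm_add_le_of_le (norm_pow_add_delta_le hadm hm hpm hy) ?_
  have h0 := inv_prime_pos p
  refine IsUltrametricDist.norm_sum_le_of_forall_le_of_nonneg (by positivity) fun q hq => ?_
  rw [norm_mul, norm_mul]
  refine (mul_le_of_le_one_right (by positivity) (norm_sub_le_of_le (hδ q) (hδ p))).trans ?_
  refine (mul_le_of_le_one_left (norm_nonneg _) (norm_intCast_le_one' p _)).trans ?_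
  have hdvd : p ^ expK n a p m ∣ coeffZ n a q m :=
    dvd_prod_of_mem (fun q => q ^ expK n a q m)
      (mem_erase.2 ⟨(ne_of_mem_erase hq).symm, hpm⟩)
  have := (norm_intCast_le_iff (p := p) (C := C) (z := coeffZ n a q m) (m := expK n a p m)).2
    (by exact_mod_cast hdvd)
  simpa using this

theorem coeffC_ne_zero (hc : IsDecomposition n a c) (m : ℕ) : coeffC n c m ≠ 0 :=
  prod_ne_zero_iff.2 fun i hi => pow_ne_zero _ (hc.squarefree i hi).ne_zero

theorem denom_ne_zero (hc : IsDecomposition n a c) (m : ℕ) : denom n a c m ≠ 0 :=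
  mul_ne_zero (coeffC_ne_zero hc m)
    (prod_ne_zero_iff.2 fun _ hq => pow_ne_zero _ (prime_of_mem_setS hq).ne_zero)

theorem norm_aeval_basisPoly_le (p : ℕ) [Fact p.Prime] {C : Type*} [NormedField C]
    [NormedAlgebra ℚ_[p] C] [IsUltrametricDist C] [CharZero C] (hc : IsDecomposition n a c)
    (hadm : IsAdmissible n a c b w u) {m : ℕ} (hm : m < n) {y : C} (hy : y ^ n = a) :
    ‖aeval y (basisPoly n a c b w u m)‖ ≤ 1 := by
  have h0 := inv_prime_pos p
  have h1 := inv_prime_lt_one p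
  have hy1 : ‖y‖ ≤ 1 := norm_le_one_of_pow_eq (by omega) hy (norm_intCast_le_one' p a)
  obtain ⟨j, hjn, hja, hjC⟩ := exists_norm_coeffC (p := p) (C := C) (by omega) hc
  rw [aeval_basisPoly, norm_div]
  refine div_le_one_of_le₀ ?_ (norm_nonneg _)
  rw [norm_denom (p := p)]
  split_ifs with hpm
  -- Here p ∤ a, so C_m is a unit at p and only the factor p^k matters.
  · have hj0 : j = 0 := by
      rw [norm_intCast_eq_one.2 (not_dvd_of_mem_setS (setSm_subset hpm))] at hja
      by_contra hne
      exact (pow_lt_one₀ h0.le h1 hne).ne hja.symm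
    rw [hjC, hj0, zero_mul, Nat.zero_div, pow_zero, one_mul]
    exact norm_pow_add_beta_le hadm hm hpm hy
  · rw [mul_one]
    refine norm_add_le_of_le ?_ ?_
    · have hyn : ‖y ^ m‖ ^ n = (p : ℝ)⁻¹ ^ (j * m) := by
        rw [← norm_pow, ← pow_mul, mul_comm m n, pow_mul, hy, norm_pow, hja, pow_mul]
      refine le_of_pow_le_pow_left₀ (n := n) (by omega) (norm_nonneg _) ?_
      rw [hyn, hjC, ← pow_mul]
      exact pow_le_pow_of_le_one h0.le h1.le (Nat.div_mul_le_self _ _)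
    · refine IsUltrametricDist.norm_sum_le_of_forall_le_of_nonneg (norm_nonneg _) fun q _ => ?_
      rw [norm_mul, norm_mul]
      refine (mul_le_of_le_one_left (norm_nonneg _) ?_).trans (norm_delta_le hy1 q m)
      exact mul_le_one₀ (norm_intCast_le_one' p _) (norm_nonneg _)
        (IsUltrametricDist.norm_natCast_le_one _ _)

end BasisIntegral

/-! ### Leading coefficients of integral elements. -/

section Maximality

theorem le_natDegree_of_aeval_eq_zero {K : Type*} [Field K] [CharZero K] {θ : K} {n : ℕ} {a : ℚ}
    (hθ : minpoly ℚ θ = X ^ n - C a) {P : ℚ[X]} (hP : P ≠ 0) (h : aeval θ P = 0) :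
    n ≤ P.natDegree := by
  have h1 := natDegree_le_of_dvd (minpoly.dvd ℚ θ h) hP
  rwa [hθ, natDegree_X_pow_sub_C] at h1

/-- Otherwise a = a^p and X^n - a would factor. This rules out the default value 0 of `padicValInt`
at 0, which would falsify r_p. -/
theorem pow_sub_one_ne_one_of_minpoly {K : Type*} [Field K] [CharZero K] {θ : K} {n : ℕ}
    (hn : 1 ≤ n) {a : ℤ} (hθ : minpoly ℚ θ = X ^ n - C (a : ℚ)) {p : ℕ} (hp : p.Prime)
    (hpn : p ∣ n) : a ^ (p - 1) ≠ 1 := by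
  intro ha
  obtain ⟨N, rfl⟩ := hpn
  have hp2 := hp.two_le
  have hN : 0 < N := Nat.pos_of_ne_zero fun h => by simp [h] at hn
  have hap : a ^ p = a := by
    rw [show p = p - 1 + 1 by omega, pow_succ, ha, one_mul]
  have hroot : θ ^ (p * N) = a := by
    have := minpoly.aeval ℚ θ
    rw [hθ] at this
    simpa [sub_eq_zero] using this
  have hle : ∀ P : ℤ[X], P.Monic → aeval θ P = 0 → p * N ≤ P.natDegree := fun P hP h => by
    rw [← hP.natDegree_map (algebraMap ℤ ℚ)]
    exact le_natDegree_of_aeval_eq_zero hθ (hP.map _).ne_zero (by rwa [aeval_map_algebraMap])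
  have hmul : geomSum₂ p (θ ^ N) (a : K) * (θ ^ N - a) = 0 := by
    rw [geomSum₂_mul, ← pow_mul, mul_comm N p, hroot, sub_eq_zero]
    exact_mod_cast hap.symm
  obtain ⟨hF, hFd⟩ := geomSum₂_X_pow_monic_natDegree p N hp.pos hN a
  rcases mul_eq_zero.1 hmul with h | h
  · have := hle _ hF (by simpa [geomSum₂, map_sum] using h)
    rw [hFd, mul_comm] at this
    have := Nat.le_of_mul_le_mul_left this hN
    omega
  · have := hle _ (monic_X_pow_sub_C a hN.ne') (by simpa using h)
    rw [natDegree_X_pow_sub_C] at this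
    nlinarith

variable {n : ℕ} {a : ℤ} {c : ℕ → ℕ}

theorem norm_denom_mul_leadingCoeff_le (p : ℕ) [hp : Fact p.Prime] (C : Type*) [NormedField C]
    [NormedAlgebra ℚ_[p] C] [IsUltrametricDist C] [IsAlgClosed C] [CharZero C]
    (hc : IsDecomposition n a c)
    (hpa : p ∣ n → ¬ (p : ℤ) ∣ a ∨ Nat.Coprime (padicValInt p a) p)
    (hne : p ∣ n → a ^ (p - 1) ≠ 1) {h : ℚ[X]} (hdeg : h.natDegree < n)
    (hh : ∀ y : C, y ^ n = a → ‖aeval y h‖ ≤ 1) :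
    ‖((denom n a c h.natDegree * h.leadingCoeff : ℚ) : ℚ_[p])‖ ≤ 1 := by
  have h0 := inv_prime_pos p
  have h1 := inv_prime_lt_one p
  have hn : 1 ≤ n := by omega
  rw [← norm_ratCast_eq (C := C), Rat.cast_mul, Rat.cast_natCast]
  set s := n.factorization p with hs
  set n' := n / p ^ s with hn'
  have hnn : n' * p ^ s = n := Nat.div_mul_cancel (Nat.ordProj_dvd n p)
  have hpn' : ¬ p ∣ n' := Nat.not_dvd_ordCompl hp.out (by omega)
  by_cases hcase : p ∣ n ∧ ¬ (p : ℤ) ∣ a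
  · obtain ⟨hpn, hpa'⟩ := hcase
    have hsub : a ^ (p - 1) - 1 ≠ 0 := sub_ne_zero.2 (hne hpn)
    have hdvd : ∀ e, (p : ℤ) ^ e ∣ a ^ (p - 1) - 1 ↔ e ≤ padicValInt p (a ^ (p - 1) - 1) :=
      fun e => by rw [padicValInt_dvd_iff]; simp [hsub]
    have hv1 : 1 ≤ padicValInt p (a ^ (p - 1) - 1) :=
      (hdvd 1).1 (by simpa using dvd_pow_sub_one_sub_one hpa')
    have hmem : p ∈ n.primeFactors := Nat.mem_primeFactors.2 ⟨hp.out, hpn, by omega⟩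
    set t := h.natDegree with ht
    have key : ∀ k ≤ s, (p : ℤ) ^ (k + 1) ∣ a ^ (p - 1) - 1 →
        (k = s ∨ ¬ (p : ℤ) ^ (k + 2) ∣ a ^ (p - 1) - 1 ∨ t < n - n / p ^ (k + 1)) →
          ‖(p : C) ^ k * (h.leadingCoeff : C)‖ ≤ 1 := by
      intro k hks hr hk
      refine norm_prime_pow_mul_leadingCoeff_le hpn' hpa' hks hr ?_ (by rwa [hnn])
        (by rwa [hnn])
      by_cases hks' : k = s
      · exact Or.inl hks'
      refine hk.imp_right (Or.imp_right fun hlt => ?_)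
      rw [hnn, ← ht]
      convert hlt using 2
      have hsplit : n = n' * p ^ (s - (k + 1)) * p ^ (k + 1) := by
        rw [mul_assoc, ← pow_add, Nat.sub_add_cancel (by omega), hnn]
      conv_rhs => rw [hsplit]
      exact (Nat.mul_div_cancel _ (pow_pos hp.out.pos _)).symm
    have hCle : ‖(coeffC n c t : C)‖ ≤ 1 := IsUltrametricDist.norm_natCast_le_one _ _
    by_cases hpS : p ∈ setS n a
    -- Maximality of k leaves three cases: k = s, k = r_p (exactness), or k below both, where t is
    -- smaller than the next threshold degree.
    · have hk := key (expK n a p t) expK_le_factorization (pow_expK_succ_dvd hpS) (by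
        by_cases hks : expK n a p t = s
        · exact Or.inl hks
        by_cases hlt : expK n a p t < expD n a p
        · exact Or.inr (Or.inr (lt_sub_div_pow_of_expK_lt (Nat.lt_succ_self _) hlt))
        · refine Or.inr (Or.inl ?_)
          rw [hdvd]
          have h2 := expK_le_factorization (n := n) (a := a) (p := p) (m := t)
          unfold expD expR at hlt
          omega)
      rw [norm_mul, norm_pow, norm_prime] at hk
      rw [norm_mul, norm_denom (p := p)]
      refine le_trans ?_ hk
      gcongr
      split_ifs with hpm
      · exact mul_le_of_le_one_left (by positivity) hCle
      · have : expK n a p t = 0 := by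
          by_contra hne
          exact hpm (mem_filter.2 ⟨hpS, Nat.one_le_iff_ne_zero.2 hne⟩)
        rwa [this, pow_zero, mul_one]
    · have hv2 : padicValInt p (a ^ (p - 1) - 1) < 2 := by
        by_contra! hcon
        refine hpS (mem_filter.2 ⟨hmem, ?_⟩)
        unfold expR
        omega
      have hk := key 0 (Nat.zero_le _) ((hdvd _).2 hv1) (Or.inr (Or.inl (by rw [hdvd]; omega)))
      rw [pow_zero, one_mul] at hk
      rw [norm_mul]
      exact mul_le_one₀ (IsUltrametricDist.norm_natCast_le_one _ _) (norm_nonneg _) hk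
  · obtain ⟨j, hjn, hja, hjC⟩ := exists_norm_coeffC (p := p) (C := C) hn hc
    have hj : Nat.Coprime (p ^ s) j := by
      by_cases hpn : p ∣ n
      · have hpa' : (p : ℤ) ∣ a := by by_contra hcon; exact hcase ⟨hpn, hcon⟩
        have hco := (hpa hpn).resolve_left (not_not.2 hpa')
        have ha0 : a ≠ 0 := by
          rintro rfl
          rw [Int.cast_zero, norm_zero] at hja
          exact (pow_pos h0 j).ne hja
        have hiff : ∀ e, e ≤ padicValInt p a ↔ e ≤ j := fun e => by
          have h2 := padicValInt_dvd_iff (p := p) e a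
          rw [← norm_intCast_le_iff (C := C), hja, pow_le_pow_iff_right_of_lt_one₀ h0 h1] at h2
          simp only [ha0, false_or] at h2
          exact h2.symm
        have : padicValInt p a = j := le_antisymm ((hiff _).1 le_rfl) ((hiff _).2 le_rfl)
        rw [← this]
        exact (hco.symm).pow_left s
      · have : s = 0 := Nat.factorization_eq_zero_of_not_dvd hpn
        simp [this]
    have key := norm_coeff_pow_mul_le_one (p := p) (C := C) hpn' hja hj (h := h) (by rwa [hnn])
      (by rwa [hnn]) h.natDegree
    rw [hnn, coeff_natDegree, hja] at key
    set t := h.natDegree with ht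
    have hfac : ‖(denom n a c t : C)‖ ≤ ‖(coeffC n c t : C)‖ := by
      rw [norm_denom (p := p)]
      refine mul_le_of_le_one_right (norm_nonneg _) ?_
      split_ifs
      · exact pow_le_one₀ h0.le h1.le
      · exact le_rfl
    rw [norm_mul]
    refine (mul_le_mul_of_nonneg_right hfac (norm_nonneg _)).trans ?_
    by_cases hl : h.leadingCoeff = 0
    · simp [hl]
    obtain ⟨v, hv⟩ := exists_norm_ratCast_eq_zpow (p := p) (C := C) hl
    rw [hv] at key ⊢
    rw [hjC, ← zpow_natCast, ← zpow_add₀ h0.ne', ← zpow_zero (p : ℝ)⁻¹,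
      zpow_le_zpow_iff_right_of_lt_one₀ h0 h1]
    rw [← zpow_natCast, ← zpow_natCast, ← zpow_natCast, ← zpow_mul, ← zpow_mul, ← zpow_add₀ h0.ne',
      ← zpow_zero (p : ℝ)⁻¹, zpow_le_zpow_iff_right_of_lt_one₀ h0 h1] at key
    -- From n v + j t ≥ 0 with v an integer one gets v ≥ -⌊jt/n⌋: rounding produces the floor in
    -- C_t.
    have hlt : ((j * t : ℕ) : ℤ) < n * ((j * t / n : ℕ) + 1 : ℤ) := by
      exact_mod_cast Nat.lt_mul_div_succ (j * t) hn
    by_contra! hcon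
    have hnv : (n : ℤ) * ((j * t / n : ℕ) + 1 : ℤ) ≤ n * (-v) :=
      mul_le_mul_of_nonneg_left (by omega) (by omega)
    rw [Nat.cast_mul] at hlt
    nlinarith

end Maximality

/-! ### Assembly of the integral basis. -/

section Basis

variable {K : Type*} [Field K] [NumberField K] {n : ℕ} {a : ℤ} {θ : K} {c : ℕ → ℕ}
  {b w u : ℕ → ℕ → ℤ}

theorem exists_aeval_eq (hn : 1 ≤ n) (hK : IntermediateField.adjoin ℚ {θ} = ⊤)
    (hθ : minpoly ℚ θ = X ^ n - C (a : ℚ)) (x : K) :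
    ∃ h : ℚ[X], h.degree < n ∧ aeval θ h = x := by
  have halg : IsIntegral ℚ θ := Algebra.IsIntegral.isIntegral θ
  have hx : x ∈ (IntermediateField.adjoin ℚ {θ}).toSubalgebra := by rw [hK]; trivial
  rw [IntermediateField.adjoin_simple_toSubalgebra_of_isAlgebraic halg.isAlgebraic,
    Algebra.adjoin_singleton_eq_range_aeval] at hx
  obtain ⟨h, rfl⟩ := hx
  refine ⟨h %ₘ minpoly ℚ θ, ?_, ?_⟩
  · have := degree_modByMonic_lt h (minpoly.monic halg)
    rwa [hθ, degree_X_pow_sub_C hn, ← hθ] at this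
  · exact aeval_modByMonic_eq_self_of_root (minpoly.aeval ℚ θ)

theorem coeff_basisPoly_self (hn : 1 ≤ n) (m : ℕ) :
    (basisPoly n a c b w u m).coeff m = (denom n a c m : ℚ)⁻¹ := by
  rw [basisPoly, coeff_C_mul, coeff_add, coeff_X_pow, if_pos rfl, coeff_map,
    coeff_eq_zero_of_degree_lt (degree_betaPoly_lt hn m), map_zero, add_zero, mul_one]

theorem degree_basisPoly (hn : 1 ≤ n) (hc : IsDecomposition n a c) (m : ℕ) :
    (basisPoly n a c b w u m).degree = m := by
  have h1 : (denom n a c m : ℚ)⁻¹ ≠ 0 := inv_ne_zero (Nat.cast_ne_zero.2 (denom_ne_zero hc m))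
  rw [basisPoly, degree_C_mul h1, degree_add_eq_left_of_degree_lt, degree_X_pow]
  rw [degree_X_pow]
  exact degree_map_le.trans_lt (degree_betaPoly_lt hn m)

theorem linearIndependent_aeval_basisPoly (hn : 1 ≤ n)
    (hθ : minpoly ℚ θ = X ^ n - C (a : ℚ)) (hc : IsDecomposition n a c) :
    LinearIndependent ℚ (fun m : Fin n => aeval θ (basisPoly n a c b w u m)) := by
  let S : Polynomial.Sequence ℚ := ⟨basisPoly n a c b w u, degree_basisPoly hn hc⟩
  have hS : LinearIndependent ℚ (fun m : Fin n => basisPoly n a c b w u m) :=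
    S.linearIndependent.comp (fun m : Fin n => (m : ℕ)) Fin.val_injective
  rw [Fintype.linearIndependent_iff] at hS ⊢
  intro g hg
  refine hS g ?_
  by_contra hne
  have h1 : aeval θ (∑ m, g m • basisPoly n a c b w u m) = 0 := by
    rw [map_sum]
    simpa using hg
  have h2 := le_natDegree_of_aeval_eq_zero hθ hne h1
  have h3 : ∑ m, g m • basisPoly n a c b w u m ∈ degreeLT ℚ n :=
    Submodule.sum_mem _ fun m _ => Submodule.smul_mem _ _ (by
      rw [mem_degreeLT, degree_basisPoly hn hc]
      exact_mod_cast m.2)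
  rw [mem_degreeLT, ← natDegree_lt_iff_degree_lt hne] at h3
  omega

theorem isIntegral_aeval_basisPoly (hθ : minpoly ℚ θ = X ^ n - C (a : ℚ))
    (hc : IsDecomposition n a c) (hadm : IsAdmissible n a c b w u) {m : ℕ} (hm : m < n) :
    IsIntegral ℤ (aeval θ (basisPoly n a c b w u m)) := by
  have hroot : θ ^ n = a := by
    have := minpoly.aeval ℚ θ
    rw [hθ] at this
    simpa [sub_eq_zero] using this
  refine isIntegral_of_norm_coeff_minpoly_le fun p _ i => ?_
  exact norm_coeff_minpoly_aeval_le (PadicAlgCl p) hroot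
    (fun y hy => norm_aeval_basisPoly_le p hc hadm hm hy) i

/-- The coefficient of degree t is an integer multiple z of that of g_t; subtracting z g_t keeps
integrality and lowers the degree. -/
theorem aeval_mem_span (hn : 1 ≤ n) (hθ : minpoly ℚ θ = X ^ n - C (a : ℚ))
    (hp : ∀ p : ℕ, p.Prime → p ∣ n → ¬ (p : ℤ) ∣ a ∨ Nat.Coprime (padicValInt p a) p)
    (hc : IsDecomposition n a c) (hadm : IsAdmissible n a c b w u) {t : ℕ} (ht : t ≤ n) :
    ∀ h : ℚ[X], h.degree < t → IsIntegral ℤ (aeval θ h) →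
      aeval θ h ∈ Submodule.span ℤ
        (Set.range fun m : Fin n => aeval θ (basisPoly n a c b w u m)) := by
  induction t with
  | zero =>
    intro h hdeg _
    have : h = 0 := degree_eq_bot.1 (by simpa using hdeg)
    rw [this, map_zero]
    exact Submodule.zero_mem _
  | succ t ih =>
    intro h hdeg hint
    by_cases h0 : h.coeff t = 0
    · refine ih (by omega) h ?_ hint
      rw [degree_lt_iff_coeff_zero] at hdeg ⊢
      intro i hi
      rcases hi.eq_or_lt with rfl | hi
      · exact h0
      · exact hdeg i hi
    have hnat : h.natDegree = t := by
      refine le_antisymm ?_ (le_natDegree_of_ne_zero h0)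
      exact natDegree_le_iff_coeff_eq_zero.2 fun i hi => (degree_lt_iff_coeff_zero _ _).1 hdeg i hi
    obtain ⟨z, hz⟩ := exists_intCast_eq_of_norm_le_one (q := denom n a c t * h.coeff t)
      fun p hpp => by
        have := norm_denom_mul_leadingCoeff_le p (PadicAlgCl p) hc (hp p hpp.out)
          (pow_sub_one_ne_one_of_minpoly hn hθ hpp.out) (h := h) (by omega)
          (fun y hy => norm_aeval_le_of_isIntegral p hθ hint hy)
        rwa [leadingCoeff, hnat] at this
    set g := basisPoly n a c b w u t with hg
    have hgmem : aeval θ g ∈ Submodule.span ℤ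
        (Set.range fun m : Fin n => aeval θ (basisPoly n a c b w u m)) :=
      Submodule.subset_span ⟨⟨t, ht⟩, rfl⟩
    have hsplit : aeval θ h = aeval θ (h - z • g) + z • aeval θ g := by
      rw [map_sub, map_zsmul, sub_add_cancel]
    have hgint := isIntegral_aeval_basisPoly hθ hc hadm ht
    rw [hsplit]
    refine Submodule.add_mem _ (ih (by omega) _ ?_ ?_) (Submodule.smul_mem _ _ hgmem)
    · rw [degree_lt_iff_coeff_zero] at hdeg ⊢
      intro i hi
      rw [coeff_sub, coeff_smul, zsmul_eq_mul]
      rcases hi.eq_or_lt with rfl | hi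
      · rw [hg, coeff_basisPoly_self hn, hz, mul_comm, ← mul_assoc, inv_mul_cancel₀, one_mul,
          sub_self]
        exact Nat.cast_ne_zero.2 (denom_ne_zero hc t)
      · rw [hdeg i hi, coeff_eq_zero_of_degree_lt, mul_zero, sub_zero]
        rw [hg, degree_basisPoly hn hc]
        exact_mod_cast hi
    · rw [map_sub, map_zsmul]
      exact hint.sub (hgint.smul z)

theorem isIntegralBasis_aeval_basisPoly (hn : 1 ≤ n)
    (hK : IntermediateField.adjoin ℚ {θ} = ⊤) (hθ : minpoly ℚ θ = X ^ n - C (a : ℚ))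
    (hp : ∀ p : ℕ, p.Prime → p ∣ n → ¬ (p : ℤ) ∣ a ∨ Nat.Coprime (padicValInt p a) p)
    (hc : IsDecomposition n a c) (hadm : IsAdmissible n a c b w u) :
    IsIntegralBasis (fun m : Fin n => aeval θ (basisPoly n a c b w u m)) := by
  let v : Fin n → NumberField.RingOfIntegers K := fun m =>
    ⟨aeval θ (basisPoly n a c b w u m), isIntegral_aeval_basisPoly hθ hc hadm m.2⟩
  let f : NumberField.RingOfIntegers K →ₗ[ℤ] K :=
    (Algebra.linearMap (NumberField.RingOfIntegers K) K).restrictScalars ℤ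
  have hfv : f ∘ v = fun m : Fin n => aeval θ (basisPoly n a c b w u m) := rfl
  have hli : LinearIndependent ℤ v := by
    refine LinearIndependent.of_comp f ?_
    rw [hfv]
    exact (linearIndependent_aeval_basisPoly hn hθ hc).restrict_scalars' ℤ
  have hspan : ⊤ ≤ Submodule.span ℤ (Set.range v) := by
    intro x _
    obtain ⟨h, hdeg, hx⟩ := exists_aeval_eq hn hK hθ (x : K)
    have hmem := aeval_mem_span hn hθ hp hc hadm le_rfl h hdeg
      (hx ▸ NumberField.RingOfIntegers.isIntegral_coe x)
    rw [hx, ← hfv, Set.range_comp, ← Submodule.map_span] at hmem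
    obtain ⟨y, hy, hyx⟩ := hmem
    rwa [NumberField.RingOfIntegers.ext hyx] at hy
  exact ⟨Module.Basis.mk hli hspan, fun m => by rw [Module.Basis.mk_apply]; rfl⟩

theorem aeval_basisPoly_zero (hn : 1 ≤ n) : aeval θ (basisPoly n a c b w u 0) = 1 := by
  have hk : ∀ p ∈ setS n a, expK n a p 0 = 0 := fun p hpS => by
    by_contra hne
    have h1 := sub_div_pow_expK_le (n := n) (a := a) (p := p) (m := 0)
    have h2 : n / p ^ expK n a p 0 < n :=
      Nat.div_lt_self hn (Nat.one_lt_pow hne (prime_of_mem_setS hpS).one_lt)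
    omega
  have hSm : setSm n a 0 = ∅ := filter_eq_empty_iff.2 fun p hpS => by rw [hk p hpS]; omega
  have hD : denom n a c 0 = 1 := by
    rw [denom, prod_congr rfl fun p hpS => by rw [hk p hpS, pow_zero]]
    simp [coeffC]
  rw [aeval_basisPoly, hD, beta, hSm]
  simp

end Basis

end PureField

theorem theorem3p1 {K : Type*} [Field K] [NumberField K] (n : ℕ) (hn : 1 ≤ n) (a : ℤ) (θ : K)
    (hK : IntermediateField.adjoin ℚ {θ} = ⊤)
    (hθ : minpoly ℚ θ = Polynomial.X ^ n - Polynomial.C (a : ℚ))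
    (ha : PureField.IsPowerFree n a)
    (hp : ∀ p : ℕ, p.Prime → p ∣ n → ¬ (p : ℤ) ∣ a ∨ Nat.Coprime (padicValInt p a) p)
    (c : ℕ → ℕ) (hc : PureField.IsDecomposition n a c) :
    (PureField.setS n a = ∅ →
      PureField.IsIntegralBasis
        (fun m : Fin n => θ ^ (m : ℕ) / (PureField.coeffC n c m : K))) ∧
    (PureField.setS n a ≠ ∅ →
      ∀ b w u : ℕ → ℕ → ℤ, PureField.IsAdmissible n a c b w u →
        PureField.IsIntegralBasis
          (fun m : Fin n =>
            if (m : ℕ) = 0 then (1 : K)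
            else (θ ^ (m : ℕ) + PureField.beta n a c b w u θ m) /
              ((PureField.coeffC n c m : K) *
                ∏ p ∈ PureField.setS n a, (p : K) ^ PureField.expK n a p m))) := by
  refine ⟨fun hS => ?_, fun _ b w u hadm => ?_⟩
  · have hSm : ∀ m, PureField.setSm n a m = ∅ := fun m =>
      Finset.subset_empty.1 (hS ▸ PureField.setSm_subset)
    -- With S empty every condition is vacuous, so part (i) is the same basis with β = 0.
    have hadm : PureField.IsAdmissible n a c 0 0 0 :=
      ⟨fun m _ p hpm => by simp [hSm] at hpm, fun m _ p hpm => by simp [hSm] at hpm,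
        fun m _ hne => by simp [hSm] at hne⟩
    convert PureField.isIntegralBasis_aeval_basisPoly hn hK hθ hp hc hadm using 2 with m
    rw [PureField.aeval_basisPoly, PureField.beta, hSm, PureField.denom, hS]
    simp
  · convert PureField.isIntegralBasis_aeval_basisPoly hn hK hθ hp hc hadm using 2 with m
    split_ifs with hm
    · rw [hm, PureField.aeval_basisPoly_zero hn]
    · rw [PureField.aeval_basisPoly, PureField.denom]
      push_cast
      rfl
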